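/- Let $$G_n=\sum_{k=0}^{n}\left(\frac{1\cdot 3\cdots(2k-1)}{2\cdot 4\cdots(2k)}\right)^2,\qquad n=0,1,2,\dots,$$ be the Landau constants (the term $k=0$ being $1$), let $\gamma$ be Euler's constant, and write $N=n+1$. There are real numbers $\alpha_1,\alpha_2,\dots$ (necessarily unique) that are the coefficients of the asymptotic expansion $$\pi G_n\sim \ln(16N)+\gamma+\sum_{k=1}^{\infty}\frac{\alpha_k}{N^k}\qquad (n\to\infty),$$ that is, for every $l\ge 0$ the truncation error $$\varepsilon_l(N)=\pi G_n-\left\{\ln(16N)+\gamma+\sum_{k=1}^{l}\frac{\alpha_k}{N^k}\right\}$$ satisfies $\varepsilon_l(N)=o(N^{-l})$ as $n\to\infty$. Moreover, with these coefficients, $$(-1)^{\frac{l(l+1)}{2}}\,\varepsilon_l(N)<0\qquad\text{for all } l=0,1,2,\dots \text{ and all } n=0,1,2,\dots .$$ -/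

import Mathlib

open Real Filter Asymptotics

/-- The Landau constant
`G_n = 1 + (1/2)^2 + ((1*3)/(2*4))^2 + ... + ((1*3*...*(2n-1))/(2*4*...*(2n)))^2`. -/
noncomputable def landauConst (n : ℕ) : ℝ :=
  ∑ k ∈ Finset.range (n + 1),
    (∏ j ∈ Finset.range k, ((2 * (j : ℝ) + 1) / (2 * (j : ℝ) + 2))) ^ 2

/-- The truncation `A_l(N) = ln(16 N) + γ + ∑_{k=1}^l α_k / N^k`, for a coefficient sequence `α`
(the value `α 0` plays no role). -/
noncomputable def granathTrunc (α : ℕ → ℝ) (l : ℕ) (N : ℝ) : ℝ :=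
  Real.log (16 * N) + Real.eulerMascheroniConstant + ∑ k ∈ Finset.Icc 1 l, α k / N ^ k

/-- The truncation error `ε_l(N) = π G_n - A_l(N)`, where `N = n + 1`. -/
noncomputable def granathError (α : ℕ → ℝ) (l n : ℕ) : ℝ :=
  π * landauConst n - granathTrunc α l ((n : ℝ) + 1)

/-- `α` is the coefficient sequence of the (Poincaré) asymptotic expansion
`π G_n ∼ ln(16 N) + γ + ∑_{k ≥ 1} α_k / N^k` as `n → ∞`, where `N = n + 1`:
for every order `l`, the truncation error is `o(N^{-l})`. -/
def IsGranathExpansion (α : ℕ → ℝ) : Prop :=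
  ∀ l : ℕ, (fun n : ℕ => granathError α l n) =o[atTop] (fun n : ℕ => 1 / ((n : ℝ) + 1) ^ l)

/-! Write `w_n` for `wallisCoeff n`, `F` for `legF` and `Q` for `legQ`. The theorem rests on an
exact Laplace representation: `π G_n - log (16 N) - γ` equals the integral over `t > 0` of `exp (-N
t) B(t)`, with `B(t) = (1 - F(t²/16)) / t - Q(t²/16) / 4` (`landauConst_eq`). To obtain it, `π w_n`
is written as the integral over `(0, ∞)` of a density carrying the factor `exp (-(n + 1/4) a)`.
Squaring becomes convolution, so `π w_n²` is the Laplace transform of `legP (t²/16)` at `n + 1/4`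
(`integral_exp_mul_legP`). Telescoping in `n` divides by `1 - exp (-t)`, and the splitting of `exp
(-u) / (1 - exp (-4u))` into a quarter of `1 / sinh u + 1 / cosh u`, with `u = t/4`, produces `F`
and `Q`. The additive constant comes from Abel's theorem and the logarithmic blow-up of a complete
elliptic integral (`eq_of_tendsto_landauConst_sub_log`).

Expanding `B` at `0` gives the asymptotic coefficients, and the truncation error is the Laplace
integral of the Taylor remainder of `B` (`granathError_landauAlpha`). The signs follow from complete
monotonicity: `F` and `Q` are integrals of products of inverse linear factors and inverse square
roots of linear factors, by Euler's product for `sinh`, so their Taylor remainders at `0` alternate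
in sign.

For odd `l` the remainders of `F` and `Q` enter `B` with the same sign and the integrand itself has
a sign (`granathError_odd`). For even `l` they compete. An exact derivative, with zero integral, is
then subtracted, which trades the remainder of `F` for that of `-F'`; the complete monotonicity of
`2 Q - (-F')` decides the sign (`cm_two_mul_legQ_sub_negDeriv_legF`, `granathError_even`). That
property is checked pole by pole on the partial fractions of the logarithmic derivative of `sinh √z
/ √z`. -/

/-! ### Complete monotonicity through finite differences -/

/-- `AltDiff a n f`: on `(a, ∞)` all iterated differences of `f` up to order `n`
have alternating sign. -/
def AltDiff (a : ℝ) : ℕ → (ℝ → ℝ) → Prop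
  | 0, f => ∀ z, a < z → 0 ≤ f z
  | n + 1, f => (∀ z, a < z → 0 ≤ f z) ∧ ∀ h, 0 ≤ h → AltDiff a n (fun z => f z - f (z + h))

/-- Complete monotonicity on `(a, ∞)`, expressed through finite differences. -/
def CM (a : ℝ) (f : ℝ → ℝ) : Prop := ∀ n, AltDiff a n f

namespace AltDiff

variable {a : ℝ} {n : ℕ} {f g : ℝ → ℝ}

theorem congr (hf : AltDiff a n f) (h : ∀ z, a < z → f z = g z) : AltDiff a n g := by
  induction n generalizing f g with
  | zero => intro z hz; rw [← h z hz]; exact hf z hz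
  | succ n ih =>
    refine ⟨fun z hz => by rw [← h z hz]; exact hf.1 z hz, fun k hk => ih (hf.2 k hk) ?_⟩
    intro z hz
    rw [h z hz, h (z + k) (by linarith)]

theorem shift (hf : AltDiff a n f) {c : ℝ} (hc : 0 ≤ c) : AltDiff a n (fun z => f (z + c)) := by
  induction n generalizing f with
  | zero => intro z hz; exact hf _ (by linarith)
  | succ n ih =>
    refine ⟨fun z hz => hf.1 _ (by linarith), fun k hk => ?_⟩
    refine (ih (hf.2 k hk)).congr fun z _ => ?_
    simp only
    ring_nf

theorem add (hf : AltDiff a n f) (hg : AltDiff a n g) : AltDiff a n (fun z => f z + g z) := by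
  induction n generalizing f g with
  | zero => intro z hz; exact add_nonneg (hf z hz) (hg z hz)
  | succ n ih =>
    refine ⟨fun z hz => add_nonneg (hf.1 z hz) (hg.1 z hz), fun k hk => ?_⟩
    refine (ih (hf.2 k hk) (hg.2 k hk)).congr fun z _ => ?_
    ring

theorem of_succ (hf : AltDiff a (n + 1) f) : AltDiff a n f := by
  induction n generalizing f with
  | zero => exact hf.1
  | succ n ih => exact ⟨hf.1, fun k hk => ih (hf.2 k hk)⟩

theorem mul (hf : AltDiff a n f) (hg : AltDiff a n g) : AltDiff a n (fun z => f z * g z) := by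
  induction n generalizing f g with
  | zero => intro z hz; exact mul_nonneg (hf z hz) (hg z hz)
  | succ n ih =>
    refine ⟨fun z hz => mul_nonneg (hf.1 z hz) (hg.1 z hz), fun k hk => ?_⟩
    -- Discrete Leibniz rule: `f g - f₊ g₊ = (f - f₊) g + f₊ (g - g₊)`, where `₊` is the shift by
    -- `k`.
    refine ((ih (hf.2 k hk) hg.of_succ).add (ih (hf.of_succ.shift hk) (hg.2 k hk))).congr
      fun z _ => ?_
    ring

theorem const {c : ℝ} (hc : 0 ≤ c) : AltDiff a n (fun _ => c) := by
  induction n generalizing c with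
  | zero => exact fun _ _ => hc
  | succ n ih => exact ⟨fun _ _ => hc, fun k _ => by simpa using ih le_rfl⟩

theorem of_tendsto {F : ℕ → ℝ → ℝ} (hF : ∀ k, AltDiff a n (F k))
    (h : ∀ z, a < z → Tendsto (fun k => F k z) atTop (nhds (f z))) : AltDiff a n f := by
  induction n generalizing f F with
  | zero => intro z hz; exact ge_of_tendsto' (h z hz) fun k => hF k z hz
  | succ n ih =>
    refine ⟨fun z hz => ge_of_tendsto' (h z hz) fun k => (hF k).1 z hz, fun c hc => ?_⟩
    exact ih (fun k => (hF k).2 c hc) fun z hz => (h z hz).sub (h _ (by linarith))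

theorem integral {X : Type*} [MeasurableSpace X] {μ : MeasureTheory.Measure X} {F : X → ℝ → ℝ}
    (hF : ∀ᵐ x ∂μ, AltDiff a n (F x))
    (h : ∀ z, a < z → MeasureTheory.Integrable (fun x => F x z) μ) :
    AltDiff a n (fun z => ∫ x, F x z ∂μ) := by
  induction n generalizing F with
  | zero =>
    exact fun z hz => MeasureTheory.integral_nonneg_of_ae (hF.mono fun x hx => hx z hz)
  | succ n ih =>
    refine ⟨fun z hz => MeasureTheory.integral_nonneg_of_ae (hF.mono fun x hx => hx.1 z hz),
      fun c hc => ?_⟩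
    refine (ih (hF.mono fun x hx => hx.2 c hc)
      fun z hz => (h z hz).sub (h (z + c) (by linarith))).congr fun z hz => ?_
    exact MeasureTheory.integral_sub (h z hz) (h _ (by linarith))

end AltDiff

namespace CM

variable {a : ℝ} {f g : ℝ → ℝ}

theorem nonneg (hf : CM a f) {z : ℝ} (hz : a < z) : 0 ≤ f z := hf 0 z hz

theorem congr (hf : CM a f) (h : ∀ z, a < z → f z = g z) : CM a g := fun n => (hf n).congr h

theorem add (hf : CM a f) (hg : CM a g) : CM a (fun z => f z + g z) := fun n => (hf n).add (hg n)

theorem mul (hf : CM a f) (hg : CM a g) : CM a (fun z => f z * g z) := fun n => (hf n).mul (hg n)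

theorem const {c : ℝ} (hc : 0 ≤ c) : CM a (fun _ => c) := fun _ => AltDiff.const hc

theorem const_mul (hf : CM a f) {c : ℝ} (hc : 0 ≤ c) : CM a (fun z => c * f z) :=
  (CM.const hc).mul hf

theorem of_tendsto {F : ℕ → ℝ → ℝ} (hF : ∀ k, CM a (F k))
    (h : ∀ z, a < z → Tendsto (fun k => F k z) atTop (nhds (f z))) : CM a f :=
  fun n => AltDiff.of_tendsto (fun k => hF k n) h

theorem integral {X : Type*} [MeasurableSpace X] {μ : MeasureTheory.Measure X} {F : X → ℝ → ℝ}
    (hF : ∀ᵐ x ∂μ, CM a (F x))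
    (h : ∀ z, a < z → MeasureTheory.Integrable (fun x => F x z) μ) :
    CM a (fun z => ∫ x, F x z ∂μ) := fun n => AltDiff.integral (hF.mono fun _ hx => hx n) h

theorem mono {b : ℝ} (hf : CM a f) (h : a ≤ b) : CM b f := by
  intro n
  have := hf n
  clear hf
  induction n generalizing f with
  | zero => exact fun z hz => this z (by linarith)
  | succ n ih =>
    exact ⟨fun z hz => this.1 z (by linarith), fun c hc => ih (this.2 c hc)⟩

theorem diff (hf : CM a f) {h : ℝ} (hh : 0 ≤ h) : CM a (fun z => f z - f (z + h)) :=
  fun n => (hf (n + 1)).2 h hh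

theorem sum {ι : Type*} (s : Finset ι) {F : ι → ℝ → ℝ} (hF : ∀ i ∈ s, CM a (F i)) :
    CM a (fun z => ∑ i ∈ s, F i z) := by
  classical
  induction s using Finset.induction_on with
  | empty => simpa using CM.const le_rfl
  | insert i s hi ih =>
    simp only [Finset.sum_insert hi]
    exact (hF i (by simp)).add (ih fun j hj => hF j (by simp [hj]))

theorem prod {ι : Type*} (s : Finset ι) {F : ι → ℝ → ℝ} (hF : ∀ i ∈ s, CM a (F i)) :
    CM a (fun z => ∏ i ∈ s, F i z) := by
  classical
  induction s using Finset.induction_on with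
  | empty => simpa using CM.const zero_le_one
  | insert i s hi ih =>
    simp only [Finset.prod_insert hi]
    exact (hF i (by simp)).mul (ih fun j hj => hF j (by simp [hj]))

theorem antitone (hf : CM a f) {x y : ℝ} (hx : a < x) (hxy : x ≤ y) : f y ≤ f x := by
  have := (hf.diff (sub_nonneg.2 hxy)).nonneg hx
  simp only [add_sub_cancel] at this
  linarith

theorem increment_le (hf : CM a f) {x y h : ℝ} (hx : a < x) (hxy : x ≤ y) (hh : 0 ≤ h) :
    f y - f (y + h) ≤ f x - f (x + h) :=
  (hf.diff hh).antitone hx hxy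

/-- Decrements over a fixed step decrease, so adjacent slopes can be compared on a grid of mesh `(y
- x) / n`. Rounding `(z - y) / s` up to an integer costs a term of order `1 / n`, which disappears
in the limit. -/
theorem convexOn (hf : CM a f) : ConvexOn ℝ (Set.Ioi a) f := by
  refine convexOn_of_slope_mono_adjacent (convex_Ioi a) ?_
  intro x y z hx _ hxy hyz
  have hxa : a < x := hx
  rw [div_le_div_iff₀ (sub_pos.2 hxy) (sub_pos.2 hyz)]
  set A := f x - f y with hA
  set B := f y - f z with hB
  have hA0 : 0 ≤ A := sub_nonneg.2 (hf.antitone hxa hxy.le)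
  suffices B * (y - x) ≤ A * (z - y) by
    rw [hA, hB] at this; nlinarith
  have key : ∀ n : ℕ, 0 < n → B * (y - x) ≤ A * (z - y) + A * (y - x) * ((n : ℝ))⁻¹ := by
    intro n hn
    have hn' : (0 : ℝ) < n := by exact_mod_cast hn
    set s := (y - x) / n with hs
    have hs0 : 0 < s := div_pos (sub_pos.2 hxy) hn'
    set m := ⌈(z - y) / s⌉₊ with hm
    have hm1 : (z - y) / s ≤ m := Nat.le_ceil _
    have hm2 : (m : ℝ) < (z - y) / s + 1 := Nat.ceil_lt_add_one (div_nonneg (by linarith) hs0.le)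
    have hns : (n : ℝ) * s = y - x := by rw [hs]; field_simp
    -- Walking back from `y` may leave the domain; the second alternative keeps the induction valid
    -- and is excluded at `k = n`, where the grid reaches `x > a`.
    have h1 : ∀ k : ℕ, (k : ℝ) * (f y - f (y + s)) ≤ f (y - k * s) - f y ∨ y - k * s ≤ a := by
      intro k
      induction k with
      | zero => left; simp
      | succ k ih =>
        by_cases hk : y - ((k + 1 : ℕ) : ℝ) * s ≤ a
        · exact Or.inr hk
        · left
          push_cast at hk ⊢
          have hk' : a < y - (k + 1) * s := by push Not at hk; exact hk
          have h2 := ih.resolve_right (by push Not; nlinarith)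
          have h3 := hf.increment_le (y := y) hk' (by nlinarith) hs0.le
          have e : y - (k + 1 : ℝ) * s + s = y - k * s := by ring
          rw [e] at h3
          linarith
    have h2 : ∀ k : ℕ, f y - f (y + k * s) ≤ (k : ℝ) * (f y - f (y + s)) := by
      intro k
      induction k with
      | zero => simp
      | succ k ih =>
        have hy : a < y := hxa.trans hxy
        have hks : 0 ≤ (k : ℝ) * s := by positivity
        have h3 := hf.increment_le (x := y) (y := y + k * s) hy (by linarith) hs0.le
        push_cast
        have e : y + (k + 1 : ℝ) * s = y + k * s + s := by ring
        rw [e]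
        linarith
    set e := f y - f (y + s)
    have h3 : (n : ℝ) * e ≤ A := by
      have := (h1 n).resolve_right (by rw [hns]; push Not; linarith)
      rwa [hns, sub_sub_cancel] at this
    have h4 : B ≤ m * e := by
      refine le_trans ?_ (h2 m)
      have : f (y + m * s) ≤ f z := by
        refine hf.antitone (by linarith) ?_
        rw [div_le_iff₀ hs0] at hm1
        linarith
      linarith
    have he : 0 ≤ e := sub_nonneg.2 (hf.antitone (by linarith) (by linarith))
    have h5 : (m : ℝ) ≤ (z - y) * n / (y - x) + 1 := by
      refine hm2.le.trans (le_of_eq ?_)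
      rw [hs]; field_simp
    have hyx : 0 < y - x := sub_pos.2 hxy
    have h6 : m * (y - x) ≤ (z - y) * n + (y - x) := by
      have := mul_le_mul_of_nonneg_right h5 hyx.le
      rwa [add_mul, div_mul_cancel₀ _ hyx.ne', one_mul] at this
    calc B * (y - x) ≤ m * e * (y - x) := by gcongr
      _ = e * (m * (y - x)) := by ring
      _ ≤ e * ((z - y) * n + (y - x)) := by gcongr
      _ = (n * e) * ((z - y) + (y - x) * (n : ℝ)⁻¹) := by field_simp
      _ ≤ A * ((z - y) + (y - x) * (n : ℝ)⁻¹) := by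
          have : 0 ≤ (z - y) + (y - x) * (n : ℝ)⁻¹ := by
            have := sub_pos.2 hyz
            positivity
          gcongr
      _ = _ := by ring
  have hlim : Tendsto (fun n : ℕ => A * (z - y) + A * (y - x) * ((n : ℝ))⁻¹) atTop
      (nhds (A * (z - y) + A * (y - x) * 0)) :=
    (tendsto_inv_atTop_nhds_zero_nat.const_mul _).const_add _
  rw [mul_zero, add_zero] at hlim
  exact ge_of_tendsto hlim ((eventually_gt_atTop 0).mono fun n hn => key n hn)

/-- Convexity supplies the right derivative, and its negative is a pointwise limit of the completely
monotone quotients with step `1 / (k + 1)`. This starts the bootstrap to smoothness. -/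
theorem neg_rightDeriv (hf : CM a f) : CM a (fun z => - derivWithin f (Set.Ioi z) z) := by
  have hpos : ∀ k : ℕ, (0 : ℝ) < 1 / ((k : ℝ) + 1) := fun k => by positivity
  refine of_tendsto (F := fun k z => ((k : ℝ) + 1) * (f z - f (z + 1 / ((k : ℝ) + 1))))
    (fun k => (hf.diff (hpos k).le).const_mul (by positivity)) fun z hz => ?_
  have hd := hf.convexOn.hasDerivWithinAt_rightDeriv_of_mem_interior
    (x := z) (by rwa [interior_Ioi])
  rw [hasDerivWithinAt_iff_tendsto_slope' (by simp)] at hd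
  have h1 : Tendsto (fun k : ℕ => z + 1 / ((k : ℝ) + 1)) atTop (nhdsWithin z (Set.Ioi z)) := by
    refine tendsto_nhdsWithin_iff.2 ⟨?_, Eventually.of_forall fun k => ?_⟩
    · simpa using (tendsto_one_div_add_atTop_nhds_zero_nat (𝕜 := ℝ)).const_add z
    · simpa using hpos k
  refine (hd.comp h1).neg.congr fun k => ?_
  simp only [Function.comp, slope_def_field]
  have := hpos k
  field_simp
  ring

/-- The right derivative is itself continuous, its negative being convex. For `y < z` it lies below
the slope over `[y, z]`, hence below the left derivative at `z`; letting `y → z` makes both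
one-sided derivatives agree. -/
theorem hasDerivAt (hf : CM a f) {z : ℝ} (hz : a < z) : HasDerivAt f (deriv f z) z := by
  have hc := hf.convexOn
  have hzi : z ∈ interior (Set.Ioi a) := by rwa [interior_Ioi]
  have hg := hf.neg_rightDeriv.convexOn.continuousOn isOpen_Ioi
  have hr := hc.hasDerivWithinAt_rightDeriv_of_mem_interior hzi
  have hl := hc.hasDerivWithinAt_leftDeriv_of_mem_interior hzi
  have hle := hc.leftDeriv_le_rightDeriv_of_mem_interior hzi
  have hge : derivWithin f (Set.Ioi z) z ≤ derivWithin f (Set.Iio z) z := by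
    have hcont : ContinuousAt (fun z => - derivWithin f (Set.Ioi z) z) z :=
      hg.continuousAt (Ioi_mem_nhds hz)
    have hcont' : Tendsto (fun y => derivWithin f (Set.Ioi y) y) (nhdsWithin z (Set.Iio z))
        (nhds (derivWithin f (Set.Ioi z) z)) := by
      have := Tendsto.neg hcont.tendsto
      simp only [neg_neg] at this
      exact this.mono_left nhdsWithin_le_nhds
    refine le_of_tendsto hcont' ?_
    filter_upwards [self_mem_nhdsWithin,
      nhdsWithin_le_nhds (Ioi_mem_nhds hz)] with y hy hya
    have h1 := hc.rightDeriv_le_slope_of_mem_interior (x := y) (y := z)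
      (by rwa [interior_Ioi]) hz hy
    have h2 := hc.slope_le_leftDeriv_of_mem_interior (x := y) (y := z) hya hzi hy
    exact h1.trans h2
  have heq := le_antisymm hle hge
  rw [heq] at hl
  have h2 := hl.union hr
  have : HasDerivAt f (derivWithin f (Set.Ioi z) z) z := by
    have h3 : HasDerivWithinAt f (derivWithin f (Set.Ioi z) z) {z}ᶜ z := by
      rwa [Set.Iio_union_Ioi] at h2
    rw [← hasDerivWithinAt_univ, ← hasDerivWithinAt_sdiff_singleton (x := z)]
    rwa [← Set.compl_eq_univ_sdiff]
  rwa [this.deriv]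

theorem neg_deriv (hf : CM a f) : CM a (fun z => - deriv f z) := by
  refine hf.neg_rightDeriv.congr fun z hz => ?_
  rw [(hf.hasDerivAt hz).hasDerivWithinAt.derivWithin (uniqueDiffWithinAt_Ioi z)]

theorem continuousOn (hf : CM a f) : ContinuousOn f (Set.Ioi a) := fun _ hz =>
  (hf.hasDerivAt hz).continuousAt.continuousWithinAt

end CM

/-! ### Exponentials, inverse linear functions and inverse square roots -/

namespace CM

theorem exp_neg_mul {a l : ℝ} (hl : 0 ≤ l) : CM a (fun z => exp (-(l * z))) := by
  intro n
  induction n with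
  | zero => exact fun z _ => (exp_pos _).le
  | succ n ih =>
    refine ⟨fun z _ => (exp_pos _).le, fun h hh => ?_⟩
    have h1 : 0 ≤ 1 - exp (-(l * h)) := by
      rw [sub_nonneg, exp_le_one_iff]; nlinarith [mul_nonneg hl hh]
    refine ((AltDiff.const h1).mul ih).congr fun z _ => ?_
    simp only
    rw [mul_add, neg_add, exp_add]
    ring

theorem inv_linear {a b K : ℝ} (hb : 0 ≤ b) (hK : 0 ≤ b * a + K) (hK0 : 0 < K) :
    CM a (fun z => (b * z + K)⁻¹) := by
  have hpos : ∀ L, 0 ≤ b * a + L → 0 < L → ∀ z, a < z → 0 < b * z + L := by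
    intro L h1 h2 z hz
    rcases hb.eq_or_lt with rfl | hb
    · simpa using h2
    · nlinarith
  intro n
  induction n generalizing K with
  | zero => exact fun z hz => (inv_pos.2 (hpos K hK hK0 z hz)).le
  | succ n ih =>
    refine ⟨fun z hz => (inv_pos.2 (hpos K hK hK0 z hz)).le, fun h hh => ?_⟩
    have hbh : 0 ≤ b * h := mul_nonneg hb hh
    refine ((AltDiff.const hbh).mul
      ((ih hK hK0).mul (ih (K := K + b * h) (by linarith) (by linarith)))).congr fun z hz => ?_
    have h1 := (hpos K hK hK0 z hz).ne'
    have h2 := (hpos (K + b * h) (by linarith) (by linarith) z hz).ne'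
    have h3 : b * (z + h) + K ≠ 0 := by convert h2 using 1; ring
    have e : b * (z + h) + K = b * z + (K + b * h) := by ring
    simp only
    rw [e]
    field_simp
    ring

theorem inv_sqrt_linear {a b K : ℝ} (hb : 0 ≤ b) (hK : 0 ≤ b * a + K) (hK0 : 0 < K) :
    CM a (fun z => (√(b * z + K))⁻¹) := by
  have hpos : ∀ z, a < z → 0 < b * z + K := by
    intro z hz
    rcases hb.eq_or_lt with rfl | hb
    · simpa using hK0
    · nlinarith
  -- The Gamma integral writes `Gamma (1/2)` times the inverse square root as a positive mixture of
  -- decaying exponentials.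
  have hmain : CM a (fun z => ∫ t in Set.Ioi (0 : ℝ),
      t ^ ((1 / 2 : ℝ) - 1) * exp (-((b * z + K) * t))) := by
    refine CM.integral ?_ fun z hz => ?_
    · filter_upwards [MeasureTheory.ae_restrict_mem measurableSet_Ioi] with t ht
      have ht0 : 0 < t := ht
      refine ((CM.exp_neg_mul (a := a) (mul_nonneg hb ht0.le)).const_mul
        (c := t ^ ((1 / 2 : ℝ) - 1) * exp (-(K * t))) (by positivity)).congr fun z _ => ?_
      rw [mul_assoc, ← exp_add]
      ring_nf
    · have := integrableOn_rpow_mul_exp_neg_mul_rpow (s := (1 / 2 : ℝ) - 1) (p := 1)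
        (b := b * z + K) (by norm_num) one_pos (hpos z hz)
      simp only [rpow_one, neg_mul] at this
      exact this
  refine (hmain.const_mul (c := (Gamma (1 / 2))⁻¹)
    (inv_nonneg.2 (Gamma_pos_of_pos (by norm_num)).le)).congr fun z hz => ?_
  have hG : Gamma (1 / 2) ≠ 0 := (Gamma_pos_of_pos (by norm_num)).ne'
  rw [integral_rpow_mul_exp_neg_mul_Ioi (by norm_num) (hpos z hz), mul_comm, mul_assoc,
    mul_inv_cancel₀ hG, mul_one, ← sqrt_eq_rpow, one_div, sqrt_inv]

end CM

/-! ### Alternating Taylor remainders -/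

/-- The operator `f ↦ -f'`. -/
noncomputable def negDeriv (f : ℝ → ℝ) : ℝ → ℝ := fun z => -deriv f z

/-- The coefficients `a_j` of the alternating Taylor expansion `f z ∼ ∑ (-1)^j a_j z^j`. -/
noncomputable def altCoeff (f : ℝ → ℝ) (j : ℕ) : ℝ := negDeriv^[j] f 0 / j.factorial

/-- The `m`-th Taylor remainder of `f` at `0`, multiplied by `(-1)^m`. -/
noncomputable def altRem (f : ℝ → ℝ) (m : ℕ) (z : ℝ) : ℝ :=
  (-1) ^ m * (f z - ∑ j ∈ Finset.range m, (-1) ^ j * altCoeff f j * z ^ j)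

/-- `f` is smooth at every point of `[0, ∞)`, with derivatives of alternating sign. -/
def SmoothCM (f : ℝ → ℝ) : Prop :=
  ∀ j z, 0 ≤ z → 0 ≤ negDeriv^[j] f z ∧ DifferentiableAt ℝ (negDeriv^[j] f) z

theorem CM.iterate_negDeriv {a : ℝ} {f : ℝ → ℝ} (hf : CM a f) (j : ℕ) :
    CM a (negDeriv^[j] f) := by
  induction j with
  | zero => exact hf
  | succ j ih => rw [Function.iterate_succ_apply']; exact ih.neg_deriv

theorem CM.smoothCM {a : ℝ} {f : ℝ → ℝ} (hf : CM a f) (ha : a < 0) : SmoothCM f := fun j _ hz =>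
  ⟨(hf.iterate_negDeriv j).nonneg (by linarith),
    ((hf.iterate_negDeriv j).hasDerivAt (by linarith)).differentiableAt⟩

theorem altRem_zero (f : ℝ → ℝ) (z : ℝ) : altRem f 0 z = f z := by simp [altRem]

theorem altRem_succ_zero (f : ℝ → ℝ) (m : ℕ) : altRem f (m + 1) 0 = 0 := by
  simp [altRem, Finset.sum_range_succ', altCoeff]

theorem altRem_succ (f : ℝ → ℝ) (m : ℕ) (z : ℝ) :
    altRem f (m + 1) z = altCoeff f m * z ^ m - altRem f m z := by
  have : ((-1 : ℝ) ^ m) * (-1) ^ m = 1 := by rw [← mul_pow]; simp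
  simp only [altRem, Finset.sum_range_succ, pow_succ]
  linear_combination (altCoeff f m * z ^ m) * this

theorem altCoeff_succ (f : ℝ → ℝ) (j : ℕ) :
    altCoeff f (j + 1) * (j + 1) = altCoeff (negDeriv f) j := by
  simp only [altCoeff, Function.iterate_succ_apply, Nat.factorial_succ]
  push_cast
  field_simp

namespace SmoothCM

variable {f g : ℝ → ℝ}

theorem negDeriv (hf : SmoothCM f) : SmoothCM (negDeriv f) := fun j z hz => hf (j + 1) z hz

theorem hasDerivAt (hf : SmoothCM f) {z : ℝ} (hz : 0 ≤ z) :
    HasDerivAt f (-_root_.negDeriv f z) z := by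
  simpa [_root_.negDeriv] using (hf 0 z hz).2.hasDerivAt

/-- This recursion drives the inductions on `m`: each derivative lowers the order by one and
replaces `f` by `-f'`, the sign `(-1)^m` being absorbed. -/
theorem hasDerivAt_altRem (hf : SmoothCM f) (m : ℕ) {z : ℝ} (hz : 0 ≤ z) :
    HasDerivAt (altRem f (m + 1)) (altRem (_root_.negDeriv f) m z) z := by
  have h1 : HasDerivAt (fun z => ∑ j ∈ Finset.range m, (-1) ^ (j + 1) * altCoeff f (j + 1) *
      z ^ (j + 1)) (∑ j ∈ Finset.range m, (-1) ^ (j + 1) * altCoeff f (j + 1) *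
      ((j + 1 : ℕ) * z ^ j)) z :=
    HasDerivAt.fun_sum fun j _ => (hasDerivAt_pow (j + 1) z).const_mul _
  have h2 := (((hf.hasDerivAt hz).sub (h1.add_const (altCoeff f 0)))).const_mul ((-1 : ℝ) ^ (m + 1))
  have e : (fun z => (-1 : ℝ) ^ (m + 1) * ((f - fun x => ∑ j ∈ Finset.range m,
      (-1) ^ (j + 1) * altCoeff f (j + 1) * x ^ (j + 1) + altCoeff f 0) z)) = altRem f (m + 1) := by
    funext y
    simp [altRem, Finset.sum_range_succ']
  rw [e] at h2
  have e2 : ∑ j ∈ Finset.range m, (-1) ^ (j + 1) * altCoeff f (j + 1) * ((j + 1 : ℕ) * z ^ j) =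
      -∑ j ∈ Finset.range m, (-1) ^ j * altCoeff (_root_.negDeriv f) j * z ^ j := by
    rw [← Finset.sum_neg_distrib]
    refine Finset.sum_congr rfl fun j _ => ?_
    rw [← altCoeff_succ]
    push_cast
    ring
  refine h2.congr_deriv ?_
  rw [e2, altRem]
  ring

theorem continuousOn_altRem (hf : SmoothCM f) (m : ℕ) : ContinuousOn (altRem f m) (Set.Ici 0) := by
  cases m with
  | zero =>
    refine ContinuousOn.congr (f := f) (fun z hz => ?_) fun z _ => altRem_zero f z
    exact (hf.hasDerivAt hz).continuousAt.continuousWithinAt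
  | succ m => exact fun z hz => (hf.hasDerivAt_altRem m hz).continuousAt.continuousWithinAt

theorem altCoeff_nonneg (hf : SmoothCM f) (j : ℕ) : 0 ≤ altCoeff f j :=
  div_nonneg (hf j 0 le_rfl).1 (Nat.cast_nonneg _)

theorem altRem_nonneg (hf : SmoothCM f) (m : ℕ) {z : ℝ} (hz : 0 ≤ z) : 0 ≤ altRem f m z := by
  induction m generalizing f z with
  | zero => rw [altRem_zero]; exact (hf 0 z hz).1
  | succ m ih =>
    have : MonotoneOn (altRem f (m + 1)) (Set.Ici 0) := by
      refine monotoneOn_of_deriv_nonneg (convex_Ici 0) (hf.continuousOn_altRem _) ?_ ?_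
      · intro x hx
        rw [interior_Ici] at hx
        exact (hf.hasDerivAt_altRem m (le_of_lt hx)).differentiableAt.differentiableWithinAt
      · intro x hx
        rw [interior_Ici] at hx
        rw [(hf.hasDerivAt_altRem m (le_of_lt hx)).deriv]
        exact ih hf.negDeriv (le_of_lt hx)
    rw [← altRem_succ_zero f m]
    exact this (Set.self_mem_Ici) hz hz

theorem altRem_le (hf : SmoothCM f) (m : ℕ) {z : ℝ} (hz : 0 ≤ z) :
    altRem f m z ≤ altCoeff f m * z ^ m := by
  have := hf.altRem_nonneg (m + 1) hz
  rw [altRem_succ] at this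
  linarith

theorem antitoneOn (hf : SmoothCM f) : AntitoneOn f (Set.Ici 0) := by
  refine antitoneOn_of_deriv_nonpos (convex_Ici 0)
    (fun z hz => (hf.hasDerivAt hz).continuousAt.continuousWithinAt) ?_ ?_
  · intro x hx
    rw [interior_Ici] at hx
    exact (hf.hasDerivAt (le_of_lt hx)).differentiableAt.differentiableWithinAt
  · intro x hx
    rw [interior_Ici] at hx
    rw [(hf.hasDerivAt (le_of_lt hx)).deriv]
    exact neg_nonpos.2 (hf 1 x (le_of_lt hx)).1

/-- If `-f'` vanished at some `z`, it would be nonpositive from there on, since it decreases, and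
`f` could not fall from `f z > 0` to `0`. Decay of `-f'` follows from the mean value theorem on
intervals of length one. -/
theorem negDeriv_pos_and_tendsto (hf : SmoothCM f) (hpos : ∀ z, 0 ≤ z → 0 < f z)
    (hlim : Tendsto f atTop (nhds 0)) :
    (∀ z, 0 ≤ z → 0 < _root_.negDeriv f z) ∧ Tendsto (_root_.negDeriv f) atTop (nhds 0) := by
  have hanti := hf.negDeriv.antitoneOn
  have hmvt : ∀ x y, 0 ≤ x → x < y → ∃ c, x < c ∧ c < y ∧
      f x - f y = _root_.negDeriv f c * (y - x) := by
    intro x y hx hxy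
    obtain ⟨c, hc, h⟩ := exists_hasDerivAt_eq_slope f (fun z => -_root_.negDeriv f z) hxy
      (fun z hz => (hf.hasDerivAt (hx.trans hz.1)).continuousAt.continuousWithinAt)
      (fun z hz => hf.hasDerivAt (hx.trans hz.1.le))
    refine ⟨c, hc.1, hc.2, ?_⟩
    rw [eq_div_iff (sub_pos.2 hxy).ne'] at h
    linarith
  constructor
  · intro z hz
    by_contra hcon
    have h0 : ∀ y, z < y → f z ≤ f y := by
      intro y hy
      obtain ⟨c, hc1, hc2, h⟩ := hmvt z y hz hy
      have h1 : _root_.negDeriv f c ≤ _root_.negDeriv f z :=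
        hanti hz (hz.trans hc1.le) hc1.le
      nlinarith
    have : f z ≤ 0 := ge_of_tendsto hlim ((eventually_gt_atTop z).mono h0)
    exact absurd (hpos z hz) (not_lt.2 this)
  · have hlim1 : Tendsto (fun z => f (z + -1)) atTop (nhds 0) :=
      hlim.comp (tendsto_atTop_add_const_right _ _ tendsto_id)
    refine tendsto_of_tendsto_of_tendsto_of_le_of_le' tendsto_const_nhds hlim1 ?_ ?_
    · filter_upwards [eventually_ge_atTop 0] with z hz using (hf 1 z hz).1
    · filter_upwards [eventually_ge_atTop 1] with z hz
      obtain ⟨c, hc1, hc2, h⟩ := hmvt (z + -1) z (by linarith) (by linarith)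
      have h1 : _root_.negDeriv f z ≤ _root_.negDeriv f c :=
        hanti (Set.mem_Ici.2 (by linarith)) (Set.mem_Ici.2 (by linarith)) hc2.le
      have h2 := hpos z (by linarith)
      nlinarith

/-- Positivity and decay pass from `f` to `-f'`, so every derivative in the induction is strictly
positive. Without decay a constant `f` would be a counterexample. -/
theorem altRem_pos (hf : SmoothCM f) (hpos : ∀ z, 0 ≤ z → 0 < f z)
    (hlim : Tendsto f atTop (nhds 0)) (m : ℕ) {z : ℝ} (hz : 0 < z) : 0 < altRem f m z := by
  induction m generalizing f z with
  | zero => rw [altRem_zero]; exact hpos z hz.le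
  | succ m ih =>
    obtain ⟨h1, h2⟩ := hf.negDeriv_pos_and_tendsto hpos hlim
    have : StrictMonoOn (altRem f (m + 1)) (Set.Ici 0) := by
      refine strictMonoOn_of_deriv_pos (convex_Ici 0) (hf.continuousOn_altRem _) ?_
      intro x hx
      rw [interior_Ici] at hx
      rw [(hf.hasDerivAt_altRem m (le_of_lt hx)).deriv]
      exact ih hf.negDeriv h1 h2 hx
    rw [← altRem_succ_zero f m]
    exact this Set.self_mem_Ici hz.le hz

end SmoothCM

/-- Remainders are linear in the function, so this is nonnegativity of the remainder of `W = c q -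
(-f')`. Complete monotonicity of `W` is only assumed to the right of `0`; differentiability at `0`
comes from `q` and `f`, and the signs there come from continuity. -/
theorem CM.altRem_sub_nonneg {a c : ℝ} {q f : ℝ → ℝ} (ha : a < 0) (hq : CM a q) (hf : CM a f)
    (hW : CM 0 (fun z => c * q z - negDeriv f z)) (m : ℕ) {z : ℝ} (hz : 0 ≤ z) :
    0 ≤ c * altRem q m z - altRem (negDeriv f) m z := by
  set W : ℝ → ℝ := fun z => c * q z - negDeriv f z with hWdef
  have hit : ∀ j z, a < z →
      negDeriv^[j] W z = c * negDeriv^[j] q z - negDeriv^[j] (negDeriv f) z := by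
    intro j
    induction j with
    | zero => intro z _; rfl
    | succ j ih =>
      intro z hz
      simp only [Function.iterate_succ_apply']
      have h1 := ((hq.iterate_negDeriv j).hasDerivAt hz).const_mul c
      have h2 := ((CM.iterate_negDeriv (f := negDeriv f) hf.neg_deriv j).hasDerivAt hz)
      have h3 := (h1.sub h2).congr_of_eventuallyEq (f₁ := negDeriv^[j] W)
        (by filter_upwards [Ioi_mem_nhds hz] with y hy using ih y hy)
      rw [negDeriv, h3.deriv, negDeriv, negDeriv]
      ring
  have hcont : ∀ j, ContinuousOn (negDeriv^[j] W) (Set.Ioi a) := by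
    intro j
    refine ContinuousOn.congr ?_ (hit j)
    exact ((hq.iterate_negDeriv j).continuousOn.const_smul c).sub
      (CM.iterate_negDeriv (f := negDeriv f) hf.neg_deriv j).continuousOn
  have hdiff : ∀ j z, a < z → DifferentiableAt ℝ (negDeriv^[j] W) z := by
    intro j z hz
    have h1 := ((hq.iterate_negDeriv j).hasDerivAt hz).const_mul c
    have h2 := ((CM.iterate_negDeriv (f := negDeriv f) hf.neg_deriv j).hasDerivAt hz)
    exact ((h1.sub h2).congr_of_eventuallyEq (f₁ := negDeriv^[j] W)
      (by filter_upwards [Ioi_mem_nhds hz] with y hy using hit j y hy)).differentiableAt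
  have hS : SmoothCM W := by
    intro j z hz
    refine ⟨?_, hdiff j z (by linarith)⟩
    rcases hz.eq_or_lt with rfl | hz
    · have h1 : Tendsto (negDeriv^[j] W) (nhdsWithin 0 (Set.Ioi 0)) (nhds (negDeriv^[j] W 0)) :=
        (hdiff j 0 ha).continuousAt.tendsto.mono_left nhdsWithin_le_nhds
      refine ge_of_tendsto h1 ?_
      filter_upwards [self_mem_nhdsWithin] with y hy using (hW.iterate_negDeriv j).nonneg hy
    · exact (hW.iterate_negDeriv j).nonneg hz
  have h := hS.altRem_nonneg m hz
  have e : altRem W m z = c * altRem q m z - altRem (negDeriv f) m z := by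
    have hc : ∀ j, altCoeff W j = c * altCoeff q j - altCoeff (negDeriv f) j := by
      intro j
      rw [altCoeff, hit j 0 ha, altCoeff, altCoeff]
      ring
    simp only [altRem, hc]
    rw [mul_left_comm, ← mul_sub]
    congr 1
    simp only [hWdef]
    rw [mul_sub, Finset.mul_sum, sub_sub_sub_comm, ← Finset.sum_sub_distrib]
    congr 1
    exact Finset.sum_congr rfl fun j _ => by ring
  rwa [e] at h

/-! ### Euler product and partial fractions of `sinh √z / √z` -/

/-- The entire function `sinh √z / √z`. -/
noncomputable def shc (z : ℝ) : ℝ := ∑' k : ℕ, z ^ k / (2 * k + 1).factorial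

theorem shc_summable_bound (R : ℝ) : Summable fun k : ℕ => |R| ^ k / (2 * k + 1).factorial := by
  refine Summable.of_nonneg_of_le (fun k => by positivity) (fun k => ?_)
    (Real.summable_pow_div_factorial |R|)
  gcongr
  omega

theorem shc_hasSum (z : ℝ) : HasSum (fun k : ℕ => z ^ k / (2 * k + 1).factorial) (shc z) := by
  refine Summable.hasSum (Summable.of_norm ?_)
  simpa [abs_div] using shc_summable_bound z

theorem continuous_shc : Continuous shc := by
  refine continuous_iff_continuousAt.2 fun z => ?_
  have h : ContinuousOn shc (Set.Icc (-(|z| + 1)) (|z| + 1)) := by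
    refine continuousOn_tsum (fun k => by fun_prop) (shc_summable_bound (|z| + 1)) ?_
    intro k x hx
    rw [norm_div, norm_pow, norm_natCast, norm_eq_abs]
    have hx' : |x| ≤ |(|z| + 1)| := (abs_le.2 hx).trans (le_abs_self _)
    gcongr
  refine h.continuousAt (Icc_mem_nhds ?_ ?_)
  · have := neg_abs_le z; linarith
  · have := le_abs_self z; linarith

theorem mul_shc_sq (u : ℝ) : u * shc (u ^ 2) = sinh u := by
  have h := (shc_hasSum (u ^ 2)).mul_left u
  refine h.unique ?_
  convert! Real.hasSum_sinh u using 2 with k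
  rw [pow_succ _ (2 * k), pow_mul]
  ring

theorem mul_shc_neg_sq (u : ℝ) : u * shc (-u ^ 2) = sin u := by
  have h := (shc_hasSum (-u ^ 2)).mul_left u
  refine h.unique ?_
  convert! Real.hasSum_sin u using 2 with k
  rw [pow_succ _ (2 * k), pow_mul, neg_pow]
  ring

theorem shc_zero : shc 0 = 1 := by
  refine (shc_hasSum 0).unique ?_
  convert! hasSum_ite_eq (0 : ℕ) (1 : ℝ) using 2 with k
  cases k <;> simp

theorem one_add_div_six_le_shc {z : ℝ} (hz : 0 ≤ z) : 1 + z / 6 ≤ shc z := by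
  have := (shc_hasSum z).summable.sum_le_tsum (Finset.range 2) (fun k _ => by positivity)
  rw [(shc_hasSum z).tsum_eq] at this
  norm_num [Finset.sum_range_succ, Nat.factorial] at this
  exact this

/-- The bound `-4` serves arguments `a² z` with `a² ≤ 4` and `z > -1`. Negative arguments give a
sine at a point of `(0, 2]`, before its first zero at `π`. -/
theorem shc_pos {z : ℝ} (hz : -4 ≤ z) : 0 < shc z := by
  rcases le_or_gt 0 z with h | h
  · have := one_add_div_six_le_shc h
    linarith
  · set u := √(-z)
    have hu : 0 < u := sqrt_pos.2 (by linarith)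
    have hu2 : u ^ 2 = -z := sq_sqrt (by linarith)
    have h1 := mul_shc_neg_sq u
    rw [hu2, neg_neg] at h1
    have h2 : 0 < sin u := sin_pos_of_pos_of_lt_pi hu (by
      have := pi_gt_three
      nlinarith)
    rw [← h1] at h2
    exact (mul_pos_iff_of_pos_left hu).1 h2

theorem shc_sin_complex {z : ℝ} {v : ℂ} (hv0 : v ≠ 0) (hv : v ^ 2 = -(z : ℂ)) :
    (shc z : ℂ) = Complex.sin v / v := by
  have h1 : HasSum (fun k : ℕ => ((z ^ k / (2 * k + 1).factorial : ℝ) : ℂ)) (shc z : ℂ) :=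
    Complex.hasSum_ofReal.2 (shc_hasSum z)
  refine h1.unique ?_
  convert! (Complex.hasSum_sin v).div_const v using 2 with k
  rw [pow_succ, pow_mul, hv, neg_pow]
  have : ((-1 : ℂ) ^ k) * (-1) ^ k = 1 := by rw [← mul_pow]; simp
  push_cast
  field_simp
  linear_combination (-(z : ℂ) ^ k / (2 * k + 1).factorial) * this

/-- Euler's sine product at `v / π`, where `v` is a complex square root of `-z`; this treats both
signs of `z` at once. -/
theorem tendsto_shc_prod (z : ℝ) :
    Tendsto (fun n : ℕ => ∏ j ∈ Finset.range n, (1 + z / (π ^ 2 * ((j : ℝ) + 1) ^ 2))) atTop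
      (nhds (shc z)) := by
  rcases eq_or_ne z 0 with rfl | hz
  · simp [shc_zero]
  obtain ⟨v, hv⟩ := IsAlgClosed.exists_pow_nat_eq (-(z : ℂ)) (n := 2) two_pos
  have hv0 : v ≠ 0 := by
    rintro rfl
    apply hz
    simpa using hv.symm
  have hpi : (π : ℂ) ≠ 0 := by exact_mod_cast pi_ne_zero
  have h := (Complex.tendsto_euler_sin_prod (v / π)).div_const v
  rw [mul_div_cancel₀ _ hpi, ← shc_sin_complex hv0 hv] at h
  have h2 := (Complex.continuous_re.tendsto _).comp h
  rw [Complex.ofReal_re] at h2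
  refine h2.congr fun n => ?_
  have : (v * ∏ j ∈ Finset.range n, ((1 : ℂ) - (v / π) ^ 2 / ((j : ℂ) + 1) ^ 2)) / v =
      ((∏ j ∈ Finset.range n, (1 + z / (π ^ 2 * ((j : ℝ) + 1) ^ 2)) : ℝ) : ℂ) := by
    rw [mul_div_cancel_left₀ _ hv0]
    push_cast
    refine Finset.prod_congr rfl fun j _ => ?_
    rw [div_pow, hv, div_div, neg_div, sub_neg_eq_add]
  rw [Function.comp_apply, this, Complex.ofReal_re]

/-- The logarithmic derivative of `shc`. -/
noncomputable def shcLogDeriv (z : ℝ) : ℝ := (√z * cosh √z / sinh √z - 1) / (2 * z)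

theorem hasDerivAt_shc {z : ℝ} (hz : 0 < z) : HasDerivAt shc (shc z * shcLogDeriv z) z := by
  have hu : 0 < √z := sqrt_pos.2 hz
  have hd := ((hasDerivAt_sinh √z).comp z (hasDerivAt_sqrt hz.ne')).div
    (hasDerivAt_sqrt hz.ne') hu.ne'
  have he : ∀ x, 0 < x → shc x = sinh √x / √x := by
    intro x hx
    rw [eq_div_iff (sqrt_pos.2 hx).ne', mul_comm]
    nth_rw 2 [← sq_sqrt hx.le]
    exact mul_shc_sq _
  refine (hd.congr_of_eventuallyEq ?_).congr_deriv ?_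
  · filter_upwards [Ioi_mem_nhds hz] with x hx using he x hx
  · have hs : sinh √z ≠ 0 := (sinh_pos_iff.2 hu).ne'
    have hz2 : z = √z ^ 2 := (sq_sqrt hz.le).symm
    rw [he z hz, shcLogDeriv]
    simp only [Function.comp]
    generalize √z = u at *
    subst hz2
    field_simp

/-- The Mittag-Leffler expansion of the cotangent, evaluated at the imaginary point `i √z / π`. -/
theorem tendsto_shcLogDeriv {z : ℝ} (hz : 0 < z) :
    Tendsto (fun n : ℕ => ∑ k ∈ Finset.range n, (z + π ^ 2 * ((k : ℝ) + 1) ^ 2)⁻¹) atTop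
      (nhds (shcLogDeriv z)) := by
  set u := √z with hu_def
  have hu : 0 < u := sqrt_pos.2 hz
  have hz2 : z = u ^ 2 := (sq_sqrt hz.le).symm
  have hpi : (π : ℂ) ≠ 0 := by exact_mod_cast pi_ne_zero
  have huc : (u : ℂ) ≠ 0 := by exact_mod_cast hu.ne'
  set x : ℂ := Complex.I * u / π with hx
  have hxmem : x ∈ Complex.integerComplement := by
    rintro ⟨m, hm⟩
    have : (x.im : ℝ) = u / π := by
      rw [hx, mul_div_assoc, ← Complex.ofReal_div, Complex.I_mul_im, Complex.ofReal_re]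
    rw [← hm] at this
    rw [Complex.intCast_im] at this
    exact (div_pos hu pi_pos).ne this
  have h := (tendsto_logDeriv_euler_cot_sub hxmem).mul_const (Complex.I / (2 * u * π))
  have h2 := (Complex.continuous_re.tendsto _).comp h
  have hlim : (π * Complex.cot (π * x) - 1 / x) * (Complex.I / (2 * u * π)) =
      ((shcLogDeriv z : ℝ) : ℂ) := by
    have e1 : (π : ℂ) * x = u * Complex.I := by rw [hx]; field_simp
    have hs : (Complex.sinh u) ≠ 0 := by
      rw [← Complex.ofReal_sinh]; exact_mod_cast (sinh_pos_iff.2 hu).ne'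
    rw [e1, Complex.cot, Complex.cos_mul_I, Complex.sin_mul_I, shcLogDeriv, ← hu_def, hz2, hx]
    push_cast
    have hI := Complex.I_ne_zero
    field_simp
  rw [hlim, Complex.ofReal_re] at h2
  refine h2.congr fun n => ?_
  have e : (∑ j ∈ Finset.range n, cotTerm x j) * (Complex.I / (2 * u * π)) =
      ((∑ k ∈ Finset.range n, (z + π ^ 2 * ((k : ℝ) + 1) ^ 2)⁻¹ : ℝ) : ℂ) := by
    rw [Finset.sum_mul]
    push_cast
    refine Finset.sum_congr rfl fun k _ => ?_
    rw [cotTerm_identity hxmem]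
    have hk : (z : ℂ) + π ^ 2 * ((k : ℂ) + 1) ^ 2 ≠ 0 := by
      have : (0 : ℝ) < z + π ^ 2 * ((k : ℝ) + 1) ^ 2 := by positivity
      exact_mod_cast this.ne'
    have hxx : (x + (k + 1)) * (x - (k + 1)) = -((z : ℂ) + π ^ 2 * ((k : ℂ) + 1) ^ 2) / π ^ 2 := by
      rw [hx, hz2]
      push_cast
      field_simp
      linear_combination (u : ℂ) ^ 2 * Complex.I_sq
    rw [hxx, hx]
    field_simp
    linear_combination (-1) * Complex.I_sq
  rw [Function.comp_apply, e, Complex.ofReal_re]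

/-- With `u = √z` both sides are `tanh u / u`, by `2 coth 2u - coth u = tanh u`. It makes the ratio
in `legQ` comparable with logarithmic derivatives. -/
theorem shc_sq_div_shc {z : ℝ} (hz : 0 < z) :
    shc z ^ 2 / shc (4 * z) = 2 * (4 * shcLogDeriv (4 * z) - shcLogDeriv z) := by
  have hu : 0 < √z := sqrt_pos.2 hz
  have hz2 : z = √z ^ 2 := (sq_sqrt hz.le).symm
  have h4 : √(4 * z) = 2 * √z := by
    rw [sqrt_mul (by norm_num), show (4 : ℝ) = 2 ^ 2 by norm_num, sqrt_sq (by norm_num)]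
  have hs : sinh √z ≠ 0 := (sinh_pos_iff.2 hu).ne'
  have hc : cosh √z ≠ 0 := (cosh_pos _).ne'
  have e1 : shc z = sinh √z / √z := by
    rw [eq_div_iff hu.ne', mul_comm]
    nth_rw 2 [hz2]
    exact mul_shc_sq _
  have e2 : shc (4 * z) = sinh (2 * √z) / (2 * √z) := by
    rw [eq_div_iff (by positivity), mul_comm, ← mul_shc_sq]
    congr 2
    nth_rw 1 [hz2]
    ring
  rw [e1, e2, shcLogDeriv, shcLogDeriv, h4, sinh_two_mul, cosh_two_mul]
  generalize √z = u at *
  subst hz2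
  field_simp
  nlinarith [cosh_sq u]

theorem sq_div_le_one {a : ℝ} (ha : a ^ 2 ≤ 4) (k : ℕ) :
    a ^ 2 / (π ^ 2 * ((k : ℝ) + 1) ^ 2) ≤ 1 := by
  rw [div_le_one (by positivity)]
  have h1 : (4 : ℝ) ≤ π ^ 2 := by nlinarith [pi_gt_three]
  have h2 : (1 : ℝ) ≤ ((k : ℝ) + 1) ^ 2 := by nlinarith [(Nat.cast_nonneg k : (0 : ℝ) ≤ k)]
  nlinarith

theorem CM.inv_sqrt_shc {a : ℝ} (ha : a ^ 2 ≤ 4) :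
    CM (-1) (fun z => (√(shc (a ^ 2 * z)))⁻¹) := by
  refine CM.of_tendsto (F := fun n z => ∏ j ∈ Finset.range n,
    (√(a ^ 2 / (π ^ 2 * ((j : ℝ) + 1) ^ 2) * z + 1))⁻¹) (fun n => CM.prod _ fun j _ => ?_) ?_
  · have := sq_div_le_one ha j
    exact CM.inv_sqrt_linear (by positivity) (by linarith) one_pos
  · intro z hz
    have hpos : 0 < shc (a ^ 2 * z) := shc_pos (by nlinarith [sq_nonneg a])
    have h := ((continuous_sqrt.tendsto _).comp (tendsto_shc_prod (a ^ 2 * z))).inv₀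
      (sqrt_pos.2 hpos).ne'
    refine h.congr fun n => ?_
    simp only [Function.comp]
    rw [Finset.prod_inv_distrib]
    congr 1
    rw [Finset.prod_congr rfl fun j _ => by rw [mul_div_right_comm, add_comm],
      sqrt_eq_rpow, ← Real.finsetProd_rpow]
    · simp_rw [sqrt_eq_rpow]
    · intro j _
      have := sq_div_le_one ha j
      have h0 : 0 ≤ a ^ 2 / (π ^ 2 * ((j : ℝ) + 1) ^ 2) := by positivity
      nlinarith

theorem CM.inv_shc : CM (-1) (fun z => (shc z)⁻¹) := by
  have h := CM.inv_sqrt_shc (a := 1) (by norm_num)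
  refine (h.mul h).congr fun z hz => ?_
  rw [one_pow, one_mul, ← mul_inv, mul_self_sqrt (shc_pos (by linarith)).le]

theorem CM.shc_div_shc : CM (-1) (fun z => shc z / shc (4 * z)) := by
  have hb : ∀ j : ℕ, 4 / (π ^ 2 * (2 * (j : ℝ) + 1) ^ 2) ≤ 1 := by
    intro j
    have := sq_div_le_one (a := 2) (by norm_num) (2 * j)
    norm_num at this ⊢
    exact this
  refine CM.of_tendsto (F := fun n z => ∏ j ∈ Finset.range n,
    (4 / (π ^ 2 * (2 * (j : ℝ) + 1) ^ 2) * z + 1)⁻¹) (fun n => CM.prod _ fun j _ => ?_) ?_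
  · have := hb j
    exact CM.inv_linear (by positivity) (by linarith) one_pos
  · intro z hz
    have hpos : 0 < shc (4 * z) := shc_pos (by linarith)
    -- Twice as many factors are taken for `4 z`: those belonging to even multiples of `π` cancel
    -- the numerator exactly, and only the odd multiples remain.
    have h2 : Tendsto (fun n : ℕ => 2 * n) atTop atTop :=
      tendsto_atTop_mono (fun n => by simp only [id]; omega) tendsto_id
    have h := (tendsto_shc_prod z).div ((tendsto_shc_prod (4 * z)).comp h2) hpos.ne'
    refine h.congr fun n => ?_
    simp only [Function.comp, Pi.div_apply]
    have hne : ∀ j : ℕ, 1 + z / (π ^ 2 * ((j : ℝ) + 1) ^ 2) ≠ 0 := by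
      intro j
      have h1 := sq_div_le_one (a := 1) (by norm_num) j
      have h0 : (0 : ℝ) < 1 ^ 2 / (π ^ 2 * ((j : ℝ) + 1) ^ 2) := by positivity
      have : z / (π ^ 2 * ((j : ℝ) + 1) ^ 2) = 1 ^ 2 / (π ^ 2 * ((j : ℝ) + 1) ^ 2) * z := by ring
      rw [this]
      nlinarith
    have hne2 : ∀ j : ℕ, 4 / (π ^ 2 * (2 * (j : ℝ) + 1) ^ 2) * z + 1 ≠ 0 := by
      intro j
      have h0 : (0 : ℝ) < 4 / (π ^ 2 * (2 * (j : ℝ) + 1) ^ 2) := by positivity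
      have := hb j
      nlinarith
    induction n with
    | zero => simp
    | succ n ih =>
      rw [Finset.prod_range_succ, show 2 * (n + 1) = 2 * n + 1 + 1 by ring,
        Finset.prod_range_succ _ (2 * n + 1), Finset.prod_range_succ _ (2 * n),
        Finset.prod_range_succ _ n, ← ih]
      have e1 : 1 + 4 * z / (π ^ 2 * (((2 * n + 1 : ℕ) : ℝ) + 1) ^ 2) =
          1 + z / (π ^ 2 * ((n : ℝ) + 1) ^ 2) := by
        have hn : (n : ℝ) + 1 ≠ 0 := by positivity
        push_cast
        rw [show (2 * (n : ℝ) + 1 + 1) = 2 * (n + 1) by ring]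
        field_simp
        ring
      have e2 : 1 + 4 * z / (π ^ 2 * (((2 * n : ℕ) : ℝ) + 1) ^ 2) =
          4 / (π ^ 2 * (2 * (n : ℝ) + 1) ^ 2) * z + 1 := by
        push_cast
        ring
      rw [e1, e2, mul_assoc _ _ (1 + z / _), mul_comm _ (1 + z / (π ^ 2 * ((n : ℝ) + 1) ^ 2)),
        mul_comm _ (1 + z / (π ^ 2 * ((n : ℝ) + 1) ^ 2)), mul_left_comm,
        mul_div_mul_left _ _ (hne n), div_mul_eq_div_div, div_eq_mul_inv _ (_ + 1 : ℝ)]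

/-! ### The Legendre function and its two quotients -/

/-- The integrand of the angular representation of the Legendre function `P_{-1/2}`. -/
noncomputable def legKernel (θ z : ℝ) : ℝ :=
  (√(shc ((1 + cos θ) ^ 2 * z)))⁻¹ * (√(shc ((1 - cos θ) ^ 2 * z)))⁻¹

/-- `legP (u ^ 2) = P_{-1/2}(cosh (2 * u))`. -/
noncomputable def legP (z : ℝ) : ℝ := π⁻¹ * ∫ θ in Set.Ioo 0 π, legKernel θ z

/-- `legF (u ^ 2) = u P_{-1/2}(cosh (2 * u)) / sinh u`. -/
noncomputable def legF (z : ℝ) : ℝ := legP z * (shc z)⁻¹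

/-- `legQ (u ^ 2) = P_{-1/2}(cosh (2 * u)) / cosh u`. -/
noncomputable def legQ (z : ℝ) : ℝ := legP z * (shc z / shc (4 * z))

theorem one_add_cos_sq_le (θ : ℝ) : (1 + cos θ) ^ 2 ≤ 4 := by
  nlinarith [cos_le_one θ, neg_one_le_cos θ]

theorem one_sub_cos_sq_le (θ : ℝ) : (1 - cos θ) ^ 2 ≤ 4 := by
  nlinarith [cos_le_one θ, neg_one_le_cos θ]

theorem cm_legKernel (θ : ℝ) : CM (-1) (legKernel θ) :=
  (CM.inv_sqrt_shc (one_add_cos_sq_le θ)).mul (CM.inv_sqrt_shc (one_sub_cos_sq_le θ))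

theorem shc_sq_mul_pos {a z : ℝ} (ha : a ^ 2 ≤ 4) (hz : -1 < z) : 0 < shc (a ^ 2 * z) :=
  shc_pos (by nlinarith [sq_nonneg a])

theorem continuous_legKernel {z : ℝ} (hz : -1 < z) : Continuous (fun θ => legKernel θ z) := by
  have h1 : Continuous fun θ => (√(shc ((1 + cos θ) ^ 2 * z)))⁻¹ :=
    (continuous_sqrt.comp (continuous_shc.comp (by fun_prop))).inv₀ fun θ =>
      (sqrt_pos.2 (shc_sq_mul_pos (one_add_cos_sq_le θ) hz)).ne'
  have h2 : Continuous fun θ => (√(shc ((1 - cos θ) ^ 2 * z)))⁻¹ :=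
    (continuous_sqrt.comp (continuous_shc.comp (by fun_prop))).inv₀ fun θ =>
      (sqrt_pos.2 (shc_sq_mul_pos (one_sub_cos_sq_le θ) hz)).ne'
  exact h1.mul h2

theorem legKernel_pos {θ z : ℝ} (hz : -1 < z) : 0 < legKernel θ z :=
  mul_pos (inv_pos.2 (sqrt_pos.2 (shc_sq_mul_pos (one_add_cos_sq_le θ) hz)))
    (inv_pos.2 (sqrt_pos.2 (shc_sq_mul_pos (one_sub_cos_sq_le θ) hz)))

theorem legKernel_zero (θ : ℝ) : legKernel θ 0 = 1 := by simp [legKernel, shc_zero]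

theorem integrable_legKernel {z : ℝ} (hz : -1 < z) :
    MeasureTheory.IntegrableOn (fun θ => legKernel θ z) (Set.Ioo 0 π) :=
  ((continuous_legKernel hz).continuousOn.integrableOn_Icc).mono_set Set.Ioo_subset_Icc_self

theorem cm_legP : CM (-1) legP :=
  (CM.integral (Eventually.of_forall cm_legKernel) fun _ hz => integrable_legKernel hz).const_mul
    (inv_nonneg.2 pi_pos.le)

theorem cm_legF : CM (-1) legF := cm_legP.mul CM.inv_shc

theorem cm_legQ : CM (-1) legQ := cm_legP.mul CM.shc_div_shc

theorem legP_zero : legP 0 = 1 := by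
  simp [legP, legKernel_zero, pi_pos.le, pi_ne_zero]

theorem legF_zero : legF 0 = 1 := by simp [legF, legP_zero, shc_zero]

theorem legP_pos {z : ℝ} (hz : -1 < z) : 0 < legP z := by
  refine mul_pos (inv_pos.2 pi_pos) ?_
  rw [MeasureTheory.setIntegral_pos_iff_support_of_nonneg_ae
    (Eventually.of_forall fun θ => (legKernel_pos hz).le) (integrable_legKernel hz)]
  have : (Function.support fun θ => legKernel θ z) = Set.univ :=
    Set.eq_univ_of_forall fun θ => (legKernel_pos hz).ne'
  simp [this, pi_pos]

theorem legP_le_one {z : ℝ} (hz : 0 ≤ z) : legP z ≤ 1 := by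
  rw [← legP_zero]
  exact cm_legP.antitone (by norm_num) hz

theorem legF_pos {z : ℝ} (hz : 0 ≤ z) : 0 < legF z :=
  mul_pos (legP_pos (by linarith)) (inv_pos.2 (shc_pos (by linarith)))

theorem tendsto_legF : Tendsto legF atTop (nhds 0) := by
  have h : Tendsto (fun z : ℝ => (1 + z / 6)⁻¹) atTop (nhds 0) :=
    tendsto_inv_atTop_zero.comp
      (tendsto_atTop_add_const_left _ _ (tendsto_id.atTop_div_const (by norm_num)))
  refine tendsto_of_tendsto_of_tendsto_of_le_of_le' tendsto_const_nhds h ?_ ?_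
  · filter_upwards [eventually_ge_atTop 0] with z hz using (legF_pos hz).le
  · filter_upwards [eventually_ge_atTop 0] with z hz
    have h1 := one_add_div_six_le_shc hz
    have h2 : (shc z)⁻¹ ≤ (1 + z / 6)⁻¹ := inv_anti₀ (by positivity) h1
    calc legF z ≤ 1 * (shc z)⁻¹ :=
          mul_le_mul_of_nonneg_right (legP_le_one hz) (inv_nonneg.2 (shc_pos (by linarith)).le)
      _ ≤ _ := by rwa [one_mul]

/-! ### Comparison of `-legF'` with `2 legQ` -/

theorem hasDerivAt_inv_sqrt_shc {a z : ℝ} (ha : 0 < a) (hz : 0 < z) :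
    HasDerivAt (fun z => (√(shc (a ^ 2 * z)))⁻¹)
      (-((√(shc (a ^ 2 * z)))⁻¹ * (a ^ 2 * shcLogDeriv (a ^ 2 * z) / 2))) z := by
  have haz : 0 < a ^ 2 * z := by positivity
  have hpos : 0 < shc (a ^ 2 * z) := shc_pos (by linarith)
  have h0 : HasDerivAt (fun z => a ^ 2 * z) (a ^ 2) z := by
    simpa using (hasDerivAt_id z).const_mul (a ^ 2)
  have h1 : HasDerivAt (fun z => shc (a ^ 2 * z))
      (shc (a ^ 2 * z) * shcLogDeriv (a ^ 2 * z) * a ^ 2) z :=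
    HasDerivAt.comp z (hasDerivAt_shc haz) h0
  have h2 := (h1.sqrt hpos.ne').inv (sqrt_pos.2 hpos).ne'
  refine h2.congr_deriv ?_
  have hs := (sqrt_pos.2 hpos).ne'
  have hsq : shc (a ^ 2 * z) = √(shc (a ^ 2 * z)) ^ 2 := (sq_sqrt hpos.le).symm
  rw [sq_sqrt hpos.le]
  nth_rw 1 [hsq]
  nth_rw 3 [hsq]
  field_simp

theorem hasDerivAt_inv_shc {z : ℝ} (hz : 0 < z) :
    HasDerivAt (fun z => (shc z)⁻¹) (-((shc z)⁻¹ * shcLogDeriv z)) z := by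
  have hpos : 0 < shc z := shc_pos (by linarith)
  refine ((hasDerivAt_shc hz).inv hpos.ne').congr_deriv ?_
  field_simp

theorem hasDerivAt_legKernel_mul {θ z : ℝ} (hθ : θ ∈ Set.Ioo 0 π) (hz : 0 < z) :
    HasDerivAt (fun z => legKernel θ z * (shc z)⁻¹)
      (-(legKernel θ z * (shc z)⁻¹ *
        ((1 + cos θ) ^ 2 * shcLogDeriv ((1 + cos θ) ^ 2 * z) / 2 +
          (1 - cos θ) ^ 2 * shcLogDeriv ((1 - cos θ) ^ 2 * z) / 2 + shcLogDeriv z))) z := by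
  have hc : cos θ ^ 2 < 1 := by
    have := sin_pos_of_mem_Ioo hθ
    nlinarith [sin_sq_add_cos_sq θ]
  have h1 : 0 < 1 + cos θ := by nlinarith
  have h2 : 0 < 1 - cos θ := by nlinarith
  refine (((hasDerivAt_inv_sqrt_shc h1 hz).mul (hasDerivAt_inv_sqrt_shc h2 hz)).mul
    (hasDerivAt_inv_shc hz)).congr_deriv ?_
  simp only [legKernel, Pi.mul_apply]
  ring

theorem tendsto_sq_mul_shcLogDeriv {a z : ℝ} (ha : 0 < a) (hz : 0 < z) :
    Tendsto (fun n : ℕ => ∑ k ∈ Finset.range n, a ^ 2 * (a ^ 2 * z + π ^ 2 * ((k : ℝ) + 1) ^ 2)⁻¹)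
      atTop (nhds (a ^ 2 * shcLogDeriv (a ^ 2 * z))) := by
  simp_rw [← Finset.mul_sum]
  exact (tendsto_shcLogDeriv (by positivity)).const_mul _

theorem CM.pole_sub_pole {a K : ℝ} (ha : a ^ 2 ≤ 4) (hK : 0 < K) :
    CM 0 (fun z => 4 * (4 * z + K)⁻¹ - a ^ 2 * (a ^ 2 * z + K)⁻¹) := by
  have h1 : CM 0 (fun z => (4 * z + K)⁻¹) := CM.inv_linear (by norm_num) (by linarith) hK
  have h2 : CM 0 (fun z => (a ^ 2 * z + K)⁻¹) := CM.inv_linear (sq_nonneg a) (by linarith) hK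
  refine ((h1.mul h2).const_mul (c := (4 - a ^ 2) * K)
    (mul_nonneg (by linarith) hK.le)).congr fun z hz => ?_
  have e1 : 4 * z + K ≠ 0 := by positivity
  have e2 : a ^ 2 * z + K ≠ 0 := by positivity
  field_simp
  ring

theorem CM.pole_sub_two_poles {k : ℕ} :
    CM 0 (fun z => 4 * (4 * z + π ^ 2 * (2 * (k : ℝ) + 1) ^ 2)⁻¹ -
      (z + π ^ 2 * ((k : ℝ) + 1) ^ 2)⁻¹) := by
  have h1 : CM 0 (fun z => (4 * z + π ^ 2 * (2 * (k : ℝ) + 1) ^ 2)⁻¹) :=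
    CM.inv_linear (by norm_num) (by rw [mul_zero, zero_add]; positivity) (by positivity)
  have h2 : CM 0 (fun z => (1 * z + π ^ 2 * ((k : ℝ) + 1) ^ 2)⁻¹) :=
    CM.inv_linear (by norm_num) (by rw [mul_zero, zero_add]; positivity) (by positivity)
  refine ((h1.mul h2).const_mul (c := π ^ 2 * (4 * (k : ℝ) + 3)) (by positivity)).congr
    fun z hz => ?_
  have e1 : 4 * z + π ^ 2 * (2 * (k : ℝ) + 1) ^ 2 ≠ 0 := by positivity
  have e2 : z + π ^ 2 * ((k : ℝ) + 1) ^ 2 ≠ 0 := by positivity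
  rw [one_mul]
  field_simp
  ring

/-- The poles are regrouped into completely monotone packets. Let `S` be the sum of `4 / (4 z + π²
k²)` over `k ≥ 1`, and let `L = shcLogDeriv z` collect its even `k`. The odd poles minus `L` give `S
- 2 L`, whose multiple by `5/2` uses up `5 L`. Half of `S` is spent against each of the `a` and `b`
sums, and the last half of `S` is positive by itself: `5/2 + 1/2 + 1/2 + 1/2 = 4`. -/
theorem CM.shcLogDeriv_bracket {a b : ℝ} (ha : 0 < a) (ha2 : a ^ 2 ≤ 4) (hb : 0 < b)
    (hb2 : b ^ 2 ≤ 4) :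
    CM 0 (fun z => 4 * (4 * shcLogDeriv (4 * z)) - 5 * shcLogDeriv z -
      a ^ 2 * shcLogDeriv (a ^ 2 * z) / 2 - b ^ 2 * shcLogDeriv (b ^ 2 * z) / 2) := by
  have hK : ∀ k : ℕ, 0 < π ^ 2 * ((k : ℝ) + 1) ^ 2 := fun k => by positivity
  refine CM.of_tendsto (F := fun n z => 5 / 2 * ∑ k ∈ Finset.range n,
      (4 * (4 * z + π ^ 2 * (2 * (k : ℝ) + 1) ^ 2)⁻¹ - (z + π ^ 2 * ((k : ℝ) + 1) ^ 2)⁻¹) +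
    1 / 2 * ∑ k ∈ Finset.range (2 * n), (4 * (4 * z + π ^ 2 * ((k : ℝ) + 1) ^ 2)⁻¹ -
      a ^ 2 * (a ^ 2 * z + π ^ 2 * ((k : ℝ) + 1) ^ 2)⁻¹) +
    1 / 2 * ∑ k ∈ Finset.range (2 * n), (4 * (4 * z + π ^ 2 * ((k : ℝ) + 1) ^ 2)⁻¹ -
      b ^ 2 * (b ^ 2 * z + π ^ 2 * ((k : ℝ) + 1) ^ 2)⁻¹) +
    2 * ∑ k ∈ Finset.range (2 * n), (4 * z + π ^ 2 * ((k : ℝ) + 1) ^ 2)⁻¹) (fun n => ?_) ?_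
  · refine CM.add (CM.add (CM.add ?_ ?_) ?_) ?_
    · exact (CM.sum _ fun k _ => CM.pole_sub_two_poles).const_mul (by norm_num)
    · exact (CM.sum _ fun k _ => CM.pole_sub_pole ha2 (hK k)).const_mul (by norm_num)
    · exact (CM.sum _ fun k _ => CM.pole_sub_pole hb2 (hK k)).const_mul (by norm_num)
    · exact (CM.sum _ fun k _ => CM.inv_linear (by norm_num)
        (by rw [mul_zero, zero_add]; exact (hK k).le) (hK k)).const_mul (by norm_num)
  · intro z hz
    have h2 : Tendsto (fun n : ℕ => 2 * n) atTop atTop :=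
      tendsto_atTop_mono (fun n => by simp only [id]; omega) tendsto_id
    have l4 := (tendsto_sq_mul_shcLogDeriv (a := 2) two_pos hz).comp h2
    have l1 := tendsto_shcLogDeriv hz
    have la := (tendsto_sq_mul_shcLogDeriv ha hz).comp h2
    have lb := (tendsto_sq_mul_shcLogDeriv hb hz).comp h2
    have h := (((l4.const_mul 4).sub (l1.const_mul 5)).sub (la.div_const 2)).sub (lb.div_const 2)
    rw [show (2 : ℝ) ^ 2 = 4 by norm_num] at h
    refine h.congr fun n => ?_
    simp only [Function.comp, Finset.sum_sub_distrib, ← Finset.mul_sum]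
    have hsplit : ∀ n : ℕ, ∑ k ∈ Finset.range (2 * n), 4 * (4 * z + π ^ 2 * ((k : ℝ) + 1) ^ 2)⁻¹ =
        ∑ k ∈ Finset.range n, 4 * (4 * z + π ^ 2 * (2 * (k : ℝ) + 1) ^ 2)⁻¹ +
        ∑ k ∈ Finset.range n, (z + π ^ 2 * ((k : ℝ) + 1) ^ 2)⁻¹ := by
      intro n
      induction n with
      | zero => simp
      | succ n ih =>
        rw [show 2 * (n + 1) = 2 * n + 1 + 1 by ring, Finset.sum_range_succ, Finset.sum_range_succ,
          ih, Finset.sum_range_succ _ n, Finset.sum_range_succ _ n]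
        have e1 : 4 * (4 * z + π ^ 2 * (((2 * n + 1 : ℕ) : ℝ) + 1) ^ 2)⁻¹ =
            (z + π ^ 2 * ((n : ℝ) + 1) ^ 2)⁻¹ := by
          have e0 : z + π ^ 2 * ((n : ℝ) + 1) ^ 2 ≠ 0 := by positivity
          have : 4 * z + π ^ 2 * (((2 * n + 1 : ℕ) : ℝ) + 1) ^ 2 =
              4 * (z + π ^ 2 * ((n : ℝ) + 1) ^ 2) := by push_cast; ring
          rw [this]
          field_simp
        rw [e1]
        push_cast
        ring
    have := hsplit n
    simp only [← Finset.mul_sum] at this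
    linear_combination (5 / 2 : ℝ) * this

/-- By convexity the derivative at `z` is at least the slope from `0`, where the value is `1`; the
function is nonnegative at `z`, so that slope is at least `-1 / z`. The bound does not involve `θ`,
as needed for differentiation under the integral. -/
theorem deriv_legKernel_mul_bounds {θ z : ℝ} (hz : 0 < z) :
    |deriv (fun z => legKernel θ z * (shc z)⁻¹) z| ≤ z⁻¹ := by
  have hcm : CM (-1) (fun z => legKernel θ z * (shc z)⁻¹) := (cm_legKernel θ).mul CM.inv_shc
  have h1 := hcm.neg_deriv.nonneg (z := z) (by linarith)
  rw [abs_of_nonpos (by linarith)]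
  have h2 := hcm.convexOn.slope_le_deriv (x := 0) (y := z) (by simp)
    (by simp only [Set.mem_Ioi]; linarith) hz (hcm.hasDerivAt (by linarith)).differentiableAt
  rw [slope_def_field, legKernel_zero, shc_zero, sub_zero] at h2
  have h3 := hcm.nonneg (z := z) (by linarith)
  have h4 : -z⁻¹ ≤ (legKernel θ z * (shc z)⁻¹ - 1 * 1⁻¹) / z := by
    rw [le_div_iff₀ hz, neg_mul, inv_mul_cancel₀ hz.ne']
    linarith
  linarith

theorem legF_eq_integral (z : ℝ) :
    legF z = π⁻¹ * ∫ θ in Set.Ioo 0 π, legKernel θ z * (shc z)⁻¹ := by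
  rw [legF, legP, MeasureTheory.integral_mul_const, mul_assoc]

theorem hasDerivAt_legF {z : ℝ} (hz : 0 < z) :
    MeasureTheory.IntegrableOn (fun θ => deriv (fun z => legKernel θ z * (shc z)⁻¹) z)
      (Set.Ioo 0 π) ∧
    HasDerivAt legF (π⁻¹ * ∫ θ in Set.Ioo 0 π, deriv (fun z => legKernel θ z * (shc z)⁻¹) z) z := by
  have hcm : ∀ θ, CM (-1) (fun z => legKernel θ z * (shc z)⁻¹) :=
    fun θ => (cm_legKernel θ).mul CM.inv_shc
  have hint : ∀ x, -1 < x →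
      MeasureTheory.IntegrableOn (fun θ => legKernel θ x * (shc x)⁻¹) (Set.Ioo 0 π) :=
    fun x hx => (integrable_legKernel hx).mul_const _
  have hmeas : MeasureTheory.AEStronglyMeasurable
      (fun θ => deriv (fun z => legKernel θ z * (shc z)⁻¹) z)
      (MeasureTheory.volume.restrict (Set.Ioo 0 π)) := by
    -- Measurability in `θ` is inherited from difference quotients in `z`.
    refine aestronglyMeasurable_of_tendsto_ae (u := atTop) (f := fun (n : ℕ) θ =>
      ((n : ℝ) + 1) * (legKernel θ (z + 1 / ((n : ℝ) + 1)) * (shc (z + 1 / ((n : ℝ) + 1)))⁻¹ -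
        legKernel θ z * (shc z)⁻¹)) (fun n => ?_) (Eventually.of_forall fun θ => ?_)
    · have hpos : (0 : ℝ) < 1 / ((n : ℝ) + 1) := by positivity
      exact (((hint _ (by linarith)).sub (hint z (by linarith))).const_mul _).aestronglyMeasurable
    · have hd := (hcm θ).hasDerivAt (z := z) (by linarith)
      rw [hasDerivAt_iff_tendsto_slope] at hd
      have h1 : Tendsto (fun k : ℕ => z + 1 / ((k : ℝ) + 1)) atTop (nhdsWithin z {z}ᶜ) := by
        refine tendsto_nhdsWithin_iff.2 ⟨?_, Eventually.of_forall fun k => ?_⟩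
        · simpa using (tendsto_one_div_add_atTop_nhds_zero_nat (𝕜 := ℝ)).const_add z
        · have : (0 : ℝ) < 1 / ((k : ℝ) + 1) := by positivity
          simpa using this.ne'
      refine (hd.comp h1).congr fun k => ?_
      simp only [Function.comp, slope_def_field]
      field_simp
      ring
  have := hasDerivAt_integral_of_dominated_loc_of_deriv_le
    (μ := MeasureTheory.volume.restrict (Set.Ioo 0 π)) (x₀ := z) (s := Set.Ioi (z / 2))
    (F := fun z θ => legKernel θ z * (shc z)⁻¹)
    (F' := fun z θ => deriv (fun z => legKernel θ z * (shc z)⁻¹) z)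
    (bound := fun _ => (z / 2)⁻¹) (Ioi_mem_nhds (by linarith)) ?_ (hint z (by linarith)) hmeas
    ?_ ?_ ?_
  · refine ⟨this.1, ?_⟩
    have h2 := this.2.const_mul π⁻¹
    exact h2.congr_of_eventuallyEq (Eventually.of_forall legF_eq_integral)
  · filter_upwards [Ioi_mem_nhds hz] with x hx
    exact (hint x (by simp only [Set.mem_Ioi] at hx; linarith)).aestronglyMeasurable
  · refine Eventually.of_forall fun θ x hx => ?_
    have hx' : z / 2 < x := hx
    rw [norm_eq_abs]
    exact (deriv_legKernel_mul_bounds (by linarith)).trans (inv_anti₀ (by linarith) hx'.le)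
  · exact MeasureTheory.integrableOn_const (by simp) (by simp)
  · refine Eventually.of_forall fun θ x hx => ?_
    have hx' : z / 2 < x := hx
    exact (hcm θ).hasDerivAt (by linarith)

/-- Under the angular integral the difference is `legKernel θ z / shc z` times the bracket of
`CM.shcLogDeriv_bracket` with `a = 1 + cos θ` and `b = 1 - cos θ`, a product of completely monotone
functions. -/
theorem cm_two_mul_legQ_sub_negDeriv_legF : CM 0 (fun z => 2 * legQ z - negDeriv legF z) := by
  have h : CM 0 (fun z => ∫ θ in Set.Ioo 0 π, (2 * (legKernel θ z * (shc z / shc (4 * z))) +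
      deriv (fun z => legKernel θ z * (shc z)⁻¹) z)) := by
    refine CM.integral ?_ fun z hz => ?_
    · filter_upwards [MeasureTheory.ae_restrict_mem measurableSet_Ioo] with θ hθ
      have hc : cos θ ^ 2 < 1 := by
        have := sin_pos_of_mem_Ioo hθ
        nlinarith [sin_sq_add_cos_sq θ]
      have h1 : 0 < 1 + cos θ := by nlinarith
      have h2 : 0 < 1 - cos θ := by nlinarith
      refine ((((cm_legKernel θ).mul CM.inv_shc).mono (b := 0) (by norm_num)).mul
        (CM.shcLogDeriv_bracket h1 (one_add_cos_sq_le θ) h2 (one_sub_cos_sq_le θ))).congr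
        fun z hz => ?_
      rw [(hasDerivAt_legKernel_mul hθ hz).deriv]
      have hs := shc_sq_div_shc hz
      have hpos : shc z ≠ 0 := (shc_pos (by linarith)).ne'
      have e : shc z / shc (4 * z) = (shc z)⁻¹ * (shc z ^ 2 / shc (4 * z)) := by
        field_simp
      rw [e, hs]
      ring
    · exact (((integrable_legKernel (by linarith)).mul_const _).const_mul 2).add
        (hasDerivAt_legF hz).1
  refine (h.const_mul (inv_nonneg.2 pi_pos.le)).congr fun z hz => ?_
  rw [MeasureTheory.integral_add (((integrable_legKernel (by linarith)).mul_const _).const_mul 2)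
    (hasDerivAt_legF hz).1, mul_add, negDeriv, (hasDerivAt_legF hz).2.deriv, sub_neg_eq_add,
    MeasureTheory.integral_const_mul, MeasureTheory.integral_mul_const, legQ, legP]
  ring

/-! ### Squared Wallis products as Laplace transforms -/

/-- The Wallis product `1·3⋯(2n-1) / (2·4⋯(2n))`. -/
noncomputable def wallisCoeff (n : ℕ) : ℝ :=
  ∏ j ∈ Finset.range n, ((2 * (j : ℝ) + 1) / (2 * (j : ℝ) + 2))

theorem integral_sin_pow_even_Ioo (n : ℕ) :
    ∫ θ in Set.Ioo 0 (π / 2), 2 * sin θ ^ (2 * n) = π * wallisCoeff n := by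
  rw [← MeasureTheory.integral_Ioc_eq_integral_Ioo,
    ← intervalIntegral.integral_of_le (by positivity), intervalIntegral.integral_const_mul, two_mul]
  have h1 := integral_sin_pow_even n
  have h2 : ∫ x in (π / 2)..π, sin x ^ (2 * n) = ∫ x in (0 : ℝ)..(π / 2), sin x ^ (2 * n) := by
    have := intervalIntegral.integral_comp_sub_left (fun x => sin x ^ (2 * n)) π
      (a := 0) (b := π / 2)
    simp only [sin_pi_sub, sub_zero] at this
    rw [this]
    congr 1
    ring
  rw [← intervalIntegral.integral_add_adjacent_intervals (b := π / 2)
    ((by fun_prop : Continuous fun x : ℝ => sin x ^ (2 * n)).intervalIntegrable _ _)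
    ((by fun_prop : Continuous fun x : ℝ => sin x ^ (2 * n)).intervalIntegrable _ _), h2] at h1
  rw [h1, wallisCoeff]

/-- The density whose Laplace transform is the Beta integral. -/
noncomputable def betaDensity (c a : ℝ) : ℝ := exp (-(c * a)) * (√(2 * sinh (a / 2)))⁻¹

theorem image_neg_two_log_sin : (fun θ => -2 * log (sin θ)) '' Set.Ioo 0 (π / 2) = Set.Ioi 0 := by
  ext a
  constructor
  · rintro ⟨θ, hθ, rfl⟩
    have h0 : 0 < sin θ := sin_pos_of_mem_Ioo ⟨hθ.1, by linarith [hθ.2, pi_pos]⟩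
    have h1 : sin θ < 1 := by
      rw [← sin_pi_div_two]
      exact sin_lt_sin_of_lt_of_le_pi_div_two (by linarith [hθ.1, pi_pos]) le_rfl hθ.2
    have := log_neg h0 h1
    simp only [Set.mem_Ioi]
    linarith
  · intro ha
    have ha0 : 0 < a := ha
    have h1 : exp (-a / 2) < 1 := exp_lt_one_iff.2 (by linarith)
    refine ⟨arcsin (exp (-a / 2)), ⟨arcsin_pos.2 (exp_pos _), arcsin_lt_pi_div_two.2 h1⟩, ?_⟩
    simp only
    rw [sin_arcsin (by linarith [exp_pos (-a / 2)]) h1.le, log_exp]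
    ring

/-- Under `a = -2 log (sin θ)` the exponential becomes `sin θ ^ (2 n + 1/2)` and `2 sinh (a / 2)`
becomes `cos² θ / sin θ`. The offset `1/4` supplies the half power of `sin θ` that makes everything
cancel. -/
theorem betaDensity_comp (n : ℕ) {θ : ℝ} (hθ : θ ∈ Set.Ioo 0 (π / 2)) :
    |(-2 * (cos θ / sin θ))| • betaDensity (n + 1 / 4) (-2 * log (sin θ)) = 2 * sin θ ^ (2 * n) := by
  have hs : 0 < sin θ := sin_pos_of_mem_Ioo ⟨hθ.1, by linarith [hθ.2, pi_pos]⟩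
  have hc : 0 < cos θ := cos_pos_of_mem_Ioo ⟨by linarith [hθ.1, pi_pos], hθ.2⟩
  have e1 : exp (-(((n : ℝ) + 1 / 4) * (-2 * log (sin θ)))) = sin θ ^ (2 * n) * √(sin θ) := by
    rw [sqrt_eq_rpow, ← rpow_natCast, ← rpow_add hs, rpow_def_of_pos hs]
    push_cast
    ring_nf
  have e2 : 2 * sinh (-2 * log (sin θ) / 2) = cos θ ^ 2 / sin θ := by
    rw [show -2 * log (sin θ) / 2 = -log (sin θ) by ring, sinh_eq, neg_neg, exp_log hs, exp_neg,
      exp_log hs, cos_sq']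
    field_simp
  rw [betaDensity, e1, e2, sqrt_div (sq_nonneg _), sqrt_sq hc.le, abs_mul, abs_neg,
    abs_of_pos (div_pos hc hs), abs_of_pos two_pos, smul_eq_mul]
  have h := sq_sqrt hs.le
  have h0 := (sqrt_pos.2 hs).ne'
  rw [inv_div]
  field_simp
  linear_combination h

theorem hasDerivAt_neg_two_log_sin {θ : ℝ} (hθ : θ ∈ Set.Ioo 0 (π / 2)) :
    HasDerivAt (fun θ => -2 * log (sin θ)) (-2 * (cos θ / sin θ)) θ :=
  ((hasDerivAt_sin θ).log
    (sin_pos_of_mem_Ioo ⟨hθ.1, by linarith [hθ.2, pi_pos]⟩).ne').const_mul _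

theorem injOn_neg_two_log_sin : Set.InjOn (fun θ => -2 * log (sin θ)) (Set.Ioo 0 (π / 2)) := by
  intro x hx y hy h
  have h0 : ∀ z ∈ Set.Ioo 0 (π / 2), 0 < sin z := fun z hz =>
    sin_pos_of_mem_Ioo ⟨hz.1, by linarith [hz.2, pi_pos]⟩
  simp only [mul_eq_mul_left_iff] at h
  have h1 := log_injOn_pos (h0 x hx) (h0 y hy) (h.resolve_right (by norm_num))
  exact injOn_sin ⟨by linarith [hx.1, pi_pos], hx.2.le⟩ ⟨by linarith [hy.1, pi_pos], hy.2.le⟩ h1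

theorem integral_betaDensity (n : ℕ) :
    ∫ a in Set.Ioi 0, betaDensity (n + 1 / 4) a = π * wallisCoeff n := by
  rw [← image_neg_two_log_sin, MeasureTheory.integral_image_eq_integral_abs_deriv_smul
    measurableSet_Ioo (fun θ hθ => (hasDerivAt_neg_two_log_sin hθ).hasDerivWithinAt)
    injOn_neg_two_log_sin, ← integral_sin_pow_even_Ioo]
  exact MeasureTheory.setIntegral_congr_fun measurableSet_Ioo fun θ hθ => betaDensity_comp n hθ

theorem integrableOn_betaDensity (n : ℕ) :
    MeasureTheory.IntegrableOn (betaDensity (n + 1 / 4)) (Set.Ioi 0) := by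
  rw [← image_neg_two_log_sin, MeasureTheory.integrableOn_image_iff_integrableOn_abs_deriv_smul
    measurableSet_Ioo (fun θ hθ => (hasDerivAt_neg_two_log_sin hθ).hasDerivWithinAt)
    injOn_neg_two_log_sin]
  refine MeasureTheory.IntegrableOn.congr_fun (f := fun θ => 2 * sin θ ^ (2 * n)) ?_
    (fun θ hθ => (betaDensity_comp n hθ).symm) measurableSet_Ioo
  exact ((by fun_prop : Continuous fun x : ℝ => 2 * sin x ^ (2 * n)).continuousOn.integrableOn_Icc
    (a := 0) (b := π / 2)).mono_set Set.Ioo_subset_Icc_self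

theorem image_mul_one_add_cos {t : ℝ} (ht : 0 < t) :
    (fun θ => t / 2 * (1 + cos θ)) '' Set.Ioo 0 π = Set.Ioo 0 t := by
  ext a
  constructor
  · rintro ⟨θ, hθ, rfl⟩
    have hs := sin_pos_of_mem_Ioo hθ
    have hc : cos θ ^ 2 < 1 := by nlinarith [sin_sq_add_cos_sq θ]
    have h1 : 0 < 1 + cos θ := by nlinarith
    have h2 : 0 < 1 - cos θ := by nlinarith
    exact ⟨by positivity, by nlinarith⟩
  · rintro ⟨h1, h2⟩
    have h3 : -1 < 2 * a / t - 1 := by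
      have : 0 < 2 * a / t := by positivity
      linarith
    have h4 : 2 * a / t - 1 < 1 := by
      have : 2 * a / t < 2 := by rw [div_lt_iff₀ ht]; linarith
      linarith
    refine ⟨arccos (2 * a / t - 1), ⟨arccos_pos.2 h4, ?_⟩, ?_⟩
    · refine lt_of_le_of_ne (arccos_le_pi _) fun h => ?_
      rw [arccos_eq_pi] at h
      linarith
    · simp only
      rw [cos_arccos h3.le h4.le]
      field_simp
      ring

/-- The exponentials combine to `exp (-c t)`. Substituting `a = (t/2)(1 + cos θ)`, so that `t - a =
(t/2)(1 - cos θ)`, the Jacobian cancels the square-root singularities at both ends and leaves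
`legKernel θ (t²/16)`. -/
theorem integral_betaDensity_conv (c : ℝ) {t : ℝ} (ht : 0 < t) :
    ∫ a in (0 : ℝ)..t, betaDensity c a * betaDensity c (t - a) =
      exp (-(c * t)) * (π * legP (t ^ 2 / 16)) := by
  rw [intervalIntegral.integral_of_le ht.le, MeasureTheory.integral_Ioc_eq_integral_Ioo,
    ← image_mul_one_add_cos ht, MeasureTheory.integral_image_eq_integral_abs_deriv_smul
      (f' := fun θ => t / 2 * -sin θ) measurableSet_Ioo
      (fun θ _ => (((hasDerivAt_cos θ).const_add 1).const_mul (t / 2)).hasDerivWithinAt),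
    legP, ← mul_assoc π, mul_inv_cancel₀ pi_ne_zero, one_mul, ← MeasureTheory.integral_const_mul]
  · refine MeasureTheory.setIntegral_congr_fun measurableSet_Ioo fun θ hθ => ?_
    have hs := sin_pos_of_mem_Ioo hθ
    have hc : cos θ ^ 2 < 1 := by nlinarith [sin_sq_add_cos_sq θ]
    have h1 : 0 < 1 + cos θ := by nlinarith
    have h2 : 0 < 1 - cos θ := by nlinarith
    have hsh : ∀ r, 0 < r → √(2 * sinh (t / 4 * r)) = √(t / 2 * r) * √(shc (r ^ 2 * (t ^ 2 / 16))) := by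
      intro r hr
      rw [← sqrt_mul (by positivity), ← mul_shc_sq]
      congr 1
      rw [show (t / 4 * r) ^ 2 = r ^ 2 * (t ^ 2 / 16) by ring]
      ring
    have e1 : t / 2 * (1 + cos θ) / 2 = t / 4 * (1 + cos θ) := by ring
    have e2 : (t - t / 2 * (1 + cos θ)) / 2 = t / 4 * (1 - cos θ) := by ring
    have e3 : √(t / 2 * (1 + cos θ)) * √(t / 2 * (1 - cos θ)) = t / 2 * sin θ := by
      rw [← sqrt_mul (by positivity), ← sqrt_sq (by positivity : 0 ≤ t / 2 * sin θ)]
      congr 1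
      rw [mul_pow, sin_sq]
      ring
    have e4 : exp (-(c * (t / 2 * (1 + cos θ)))) * exp (-(c * (t - t / 2 * (1 + cos θ)))) =
        exp (-(c * t)) := by
      rw [← exp_add]; ring_nf
    simp only [betaDensity, e1, e2, hsh _ h1, hsh _ h2, legKernel, smul_eq_mul, abs_mul, abs_neg,
      abs_of_pos hs, abs_of_pos (half_pos ht)]
    rw [← e4, ← e3]
    have p1 : √(t / 2 * (1 + cos θ)) ≠ 0 := (sqrt_pos.2 (by positivity)).ne'
    have p2 : √(t / 2 * (1 - cos θ)) ≠ 0 := (sqrt_pos.2 (by positivity)).ne'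
    generalize √(t / 2 * (1 + cos θ)) = A at *
    generalize √(t / 2 * (1 - cos θ)) = B at *
    simp only [mul_inv]
    field_simp
  · intro x hx y hy h
    simp only [mul_eq_mul_left_iff] at h
    have := h.resolve_right (by positivity)
    exact injOn_cos ⟨hx.1.le, hx.2.le⟩ ⟨hy.1.le, hy.2.le⟩ (by linarith)

theorem integral_exp_mul_legP (n : ℕ) :
    ∫ t in Set.Ioi (0 : ℝ), exp (-((n + 1 / 4) * t)) * legP (t ^ 2 / 16) =
      π * wallisCoeff n ^ 2 := by
  have h := MeasureTheory.integral_posConvolution (integrableOn_betaDensity n)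
    (integrableOn_betaDensity n) (ContinuousLinearMap.mul ℝ ℝ)
  simp only [ContinuousLinearMap.mul_apply'] at h
  rw [integral_betaDensity, MeasureTheory.setIntegral_congr_fun measurableSet_Ioi
    (fun t ht => integral_betaDensity_conv (n + 1 / 4) ht)] at h
  simp_rw [mul_left_comm _ π] at h
  rw [MeasureTheory.integral_const_mul] at h
  have hpi := pi_ne_zero
  refine mul_left_cancel₀ hpi (h.trans ?_)
  ring

/-! ### The additive constant `log 16 + γ` -/

theorem wallisCoeff_succ (n : ℕ) :
    wallisCoeff (n + 1) = wallisCoeff n * ((2 * (n : ℝ) + 1) / (2 * (n : ℝ) + 2)) :=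
  Finset.prod_range_succ _ _

theorem wallisCoeff_pos (n : ℕ) : 0 < wallisCoeff n := Finset.prod_pos fun j _ => by positivity

theorem wallisCoeff_le_one (n : ℕ) : wallisCoeff n ≤ 1 :=
  Finset.prod_le_one (fun j _ => by positivity) fun j _ => by
    rw [div_le_one (by positivity)]; linarith

theorem wallisCoeff_eq_choose (n : ℕ) : wallisCoeff n = Ring.choose ((1 / 2 : ℝ) + n - 1) n := by
  rw [← Ring.multichoose_eq]
  have h := Ring.factorial_nsmul_multichoose_eq_ascPochhammer (1 / 2 : ℝ) n
  rw [Polynomial.ascPochhammer_smeval_eq_eval, nsmul_eq_mul] at h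
  have hn : (n.factorial : ℝ) ≠ 0 := by positivity
  refine mul_left_cancel₀ hn (Eq.trans ?_ h.symm)
  clear h hn
  induction n with
  | zero => simp [wallisCoeff]
  | succ n ih =>
    rw [ascPochhammer_succ_eval, ← ih, wallisCoeff_succ, Nat.factorial_succ]
    push_cast
    field_simp
    ring

theorem hasSum_wallisCoeff {y : ℝ} (hy : |y| < 1) :
    HasSum (fun n => wallisCoeff n * y ^ n) (√(1 - y))⁻¹ := by
  have h := (one_div_one_sub_rpow_hasFPowerSeriesOnBall_zero (1 / 2)).hasSum (y := y)
    (by simpa [enorm_eq_nnnorm, ← NNReal.coe_lt_coe] using hy)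
  simp only [FormalMultilinearSeries.ofScalars_apply_eq, zero_add, smul_eq_mul,
    ← wallisCoeff_eq_choose] at h
  rwa [← sqrt_eq_rpow, one_div] at h

theorem integral_sin_pow_Ioo (n : ℕ) :
    ∫ θ in Set.Ioo 0 π, sin θ ^ (2 * n) = π * wallisCoeff n := by
  rw [← MeasureTheory.integral_Ioc_eq_integral_Ioo,
    ← intervalIntegral.integral_of_le pi_pos.le, integral_sin_pow_even, wallisCoeff]

/-- The binomial series is integrated termwise; one factor `wallisCoeff n` is the binomial
coefficient, the other comes from the integral of `sin θ ^ (2 n)`. -/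
theorem hasSum_wallisCoeff_sq {x : ℝ} (hx0 : 0 < x) (hx1 : x < 1) :
    HasSum (fun n => π * wallisCoeff n ^ 2 * x ^ n)
      (∫ θ in Set.Ioo 0 π, (√(1 - x * sin θ ^ 2))⁻¹) := by
  have hcont : ∀ n : ℕ, Continuous fun θ => wallisCoeff n * (x * sin θ ^ 2) ^ n :=
    fun n => by fun_prop
  have hint : ∀ n : ℕ, MeasureTheory.IntegrableOn
      (fun θ => wallisCoeff n * (x * sin θ ^ 2) ^ n) (Set.Ioo 0 π) := fun n =>
    ((hcont n).continuousOn.integrableOn_Icc).mono_set Set.Ioo_subset_Icc_self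
  have hval : ∀ n : ℕ, ∫ θ in Set.Ioo 0 π, wallisCoeff n * (x * sin θ ^ 2) ^ n =
      π * wallisCoeff n ^ 2 * x ^ n := by
    intro n
    simp_rw [mul_pow, ← pow_mul, ← mul_assoc]
    rw [MeasureTheory.integral_const_mul, integral_sin_pow_Ioo]
    ring
  have hnorm : ∀ n : ℕ, ∫ θ in Set.Ioo 0 π, ‖wallisCoeff n * (x * sin θ ^ 2) ^ n‖ =
      π * wallisCoeff n ^ 2 * x ^ n := by
    intro n
    rw [← hval n]
    congr 1
    funext θ
    exact norm_of_nonneg (mul_nonneg (wallisCoeff_pos n).le (by positivity))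
  have h := MeasureTheory.hasSum_integral_of_summable_integral_norm hint (by
    simp_rw [hnorm]
    refine Summable.of_nonneg_of_le (fun n => by positivity) (fun n => ?_)
      ((summable_geometric_of_lt_one hx0.le hx1).mul_left π)
    have h1 : wallisCoeff n ^ 2 ≤ 1 := pow_le_one₀ (wallisCoeff_pos n).le (wallisCoeff_le_one n)
    have : 0 ≤ x ^ n := by positivity
    calc π * wallisCoeff n ^ 2 * x ^ n ≤ π * 1 * x ^ n := by gcongr
      _ = _ := by ring)
  simp_rw [hval] at h
  have e : ∫ θ in Set.Ioo 0 π, (√(1 - x * sin θ ^ 2))⁻¹ =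
      ∫ θ in Set.Ioo 0 π, ∑' n, wallisCoeff n * (x * sin θ ^ 2) ^ n := by
    refine MeasureTheory.setIntegral_congr_fun measurableSet_Ioo fun θ _ => ?_
    refine (hasSum_wallisCoeff ?_).tsum_eq.symm
    rw [abs_of_nonneg (by positivity)]
    nlinarith [sin_sq_le_one θ, sq_nonneg (sin θ)]
  rwa [e]

theorem integral_sin_div_sqrt {x : ℝ} (hx0 : 0 < x) (hx1 : x < 1) :
    ∫ θ in Set.Ioo 0 π, sin θ * (√(1 - x * sin θ ^ 2))⁻¹ =
      (2 * log (1 + √x) - log (1 - x)) / √x := by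
  have hy : 0 < √x := sqrt_pos.2 hx0
  have hy1 : √x < 1 := by
    rw [sqrt_lt' one_pos]; linarith
  have hyx : √x ^ 2 = x := sq_sqrt hx0.le
  have hpos : ∀ θ, 0 < 1 - x * sin θ ^ 2 := fun θ => by
    nlinarith [sin_sq_le_one θ, sq_nonneg (sin θ)]
  have hlin : ∀ θ, 0 < √x * cos θ + √(1 - x * sin θ ^ 2) := by
    intro θ
    have h1 := sqrt_pos.2 (hpos θ)
    have h2 := sq_sqrt (hpos θ).le
    have h3 := sin_sq_add_cos_sq θ
    by_contra hcon
    push Not at hcon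
    have h4 : √(1 - x * sin θ ^ 2) ≤ -(√x * cos θ) := by linarith
    have h5 := mul_self_le_mul_self h1.le h4
    nlinarith
  -- An explicit primitive; the argument of the logarithm stays positive because `x cos² θ < 1 - x
  -- sin² θ` when `x < 1`.
  have hderiv : ∀ θ, HasDerivAt (fun θ => -(log (√x * cos θ + √(1 - x * sin θ ^ 2)) / √x))
      (sin θ * (√(1 - x * sin θ ^ 2))⁻¹) θ := by
    intro θ
    have h1 : HasDerivAt (fun θ => 1 - x * sin θ ^ 2) (-(x * (2 * sin θ * cos θ))) θ := by
      have := (((hasDerivAt_sin θ).pow 2).const_mul x).const_sub 1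
      simpa using this
    have h2 := (((hasDerivAt_cos θ).const_mul √x).add (h1.sqrt (hpos θ).ne')).log (hlin θ).ne'
    refine ((h2.div_const √x).neg).congr_deriv ?_
    have h3 := (sqrt_pos.2 (hpos θ)).ne'
    have h4 := (hlin θ).ne'
    simp only [Pi.add_apply]
    generalize √(1 - x * sin θ ^ 2) = D at *
    field_simp
    linear_combination (-(sin θ * cos θ)) * hyx
  have hc : Continuous fun θ => sin θ * (√(1 - x * sin θ ^ 2))⁻¹ :=
    continuous_sin.mul ((by fun_prop : Continuous fun θ => √(1 - x * sin θ ^ 2)).inv₀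
      fun θ => (sqrt_pos.2 (hpos θ)).ne')
  rw [← MeasureTheory.integral_Ioc_eq_integral_Ioo, ← intervalIntegral.integral_of_le pi_pos.le,
    intervalIntegral.integral_eq_sub_of_hasDerivAt (fun θ _ => hderiv θ)
      (hc.intervalIntegrable _ _)]
  have h1 : 1 - x = (1 + √x) * (1 - √x) := by linear_combination hyx
  simp only [cos_pi, sin_pi, cos_zero, sin_zero]
  norm_num
  rw [h1, log_mul (by positivity) (by linarith), add_comm (√x) 1]
  ring_nf

theorem integral_one_sub_sin_div :
    ∫ θ in Set.Ioo 0 π, (1 - sin θ) * (√(1 - sin θ ^ 2))⁻¹ = 2 * log 2 := by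
  have h : ∀ θ ∈ Set.Ioo 0 π, (1 - sin θ) * (√(1 - sin θ ^ 2))⁻¹ = |cos θ| / (1 + sin θ) := by
    intro θ hθ
    have hs := sin_pos_of_mem_Ioo hθ
    rw [← cos_sq', sqrt_sq_eq_abs]
    rcases eq_or_ne (cos θ) 0 with hc | hc
    · simp [hc]
    · have h1 : |cos θ| ≠ 0 := abs_ne_zero.2 hc
      have h2 : |cos θ| ^ 2 = (1 - sin θ) * (1 + sin θ) := by rw [sq_abs, cos_sq']; ring
      field_simp
      exact h2.symm
  rw [MeasureTheory.setIntegral_congr_fun measurableSet_Ioo h,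
    ← MeasureTheory.integral_Ioc_eq_integral_Ioo, ← intervalIntegral.integral_of_le pi_pos.le]
  have hpos : ∀ θ ∈ Set.Icc 0 π, 0 < 1 + sin θ := fun θ hθ => by
    linarith [sin_nonneg_of_mem_Icc hθ]
  have hderiv : ∀ θ ∈ Set.Icc 0 π,
      HasDerivAt (fun θ => log (1 + sin θ)) (cos θ / (1 + sin θ)) θ := fun θ hθ =>
    ((hasDerivAt_sin θ).const_add 1).log (hpos θ hθ).ne'
  have hcont : ContinuousOn (fun θ => cos θ / (1 + sin θ)) (Set.Icc 0 π) :=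
    continuous_cos.continuousOn.div (by fun_prop) fun θ hθ => (hpos θ hθ).ne'
  have hcont2 : ContinuousOn (fun θ => |cos θ| / (1 + sin θ)) (Set.Icc 0 π) :=
    (by fun_prop : Continuous fun θ => |cos θ|).continuousOn.div (by fun_prop)
      fun θ hθ => (hpos θ hθ).ne'
  have hp := pi_pos
  have i1 : Set.uIcc 0 (π / 2) ⊆ Set.Icc 0 π := by
    rw [Set.uIcc_of_le (by positivity)]
    exact Set.Icc_subset_Icc_right (by linarith)
  have i2 : Set.uIcc (π / 2) π ⊆ Set.Icc 0 π := by
    rw [Set.uIcc_of_le (by linarith)]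
    exact Set.Icc_subset_Icc_left (by linarith)
  rw [← intervalIntegral.integral_add_adjacent_intervals (b := π / 2)
    (hcont2.mono i1).intervalIntegrable (hcont2.mono i2).intervalIntegrable]
  have e1 : ∫ θ in (0 : ℝ)..(π / 2), |cos θ| / (1 + sin θ) = log 2 := by
    rw [intervalIntegral.integral_congr (g := fun θ => cos θ / (1 + sin θ)) ?_,
      intervalIntegral.integral_eq_sub_of_hasDerivAt (fun θ hθ => hderiv θ (i1 hθ))
        (hcont.mono i1).intervalIntegrable]
    · norm_num
    · intro θ hθ
      rw [Set.uIcc_of_le (by positivity)] at hθ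
      simp only
      rw [abs_of_nonneg (cos_nonneg_of_mem_Icc ⟨by linarith [hθ.1], hθ.2⟩)]
  have e2 : ∫ θ in (π / 2)..π, |cos θ| / (1 + sin θ) = log 2 := by
    rw [intervalIntegral.integral_congr (g := fun θ => -(cos θ / (1 + sin θ))) ?_,
      intervalIntegral.integral_neg,
      intervalIntegral.integral_eq_sub_of_hasDerivAt (fun θ hθ => hderiv θ (i2 hθ))
        (hcont.mono i2).intervalIntegrable]
    · norm_num
    · intro θ hθ
      rw [Set.uIcc_of_le (by linarith)] at hθ
      simp only
      rw [abs_of_nonpos (cos_nonpos_of_pi_div_two_le_of_le hθ.1 (by linarith [hθ.2])), neg_div]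
  rw [e1, e2]
  ring

/-- The factor `1 - sin θ` removes the singularity at `θ = π/2`, keeping the integrand below `1`
uniformly in `x < 1`. -/
theorem tendsto_integral_one_sub_sin_div :
    Tendsto (fun x : ℝ => ∫ θ in Set.Ioo 0 π, (1 - sin θ) * (√(1 - x * sin θ ^ 2))⁻¹)
      (nhdsWithin 1 (Set.Iio 1)) (nhds (2 * log 2)) := by
  rw [← integral_one_sub_sin_div]
  refine MeasureTheory.tendsto_integral_filter_of_dominated_convergence (fun _ => 1) ?_ ?_ ?_ ?_
  · refine Eventually.of_forall fun x => Measurable.aestronglyMeasurable ?_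
    fun_prop
  · filter_upwards [self_mem_nhdsWithin] with x hx
    have hx1 : x < 1 := hx
    filter_upwards [MeasureTheory.ae_restrict_mem measurableSet_Ioo] with θ hθ
    have hs := sin_le_one θ
    have hs0 := sin_pos_of_mem_Ioo hθ
    rw [norm_mul, norm_inv, norm_of_nonneg (by linarith), norm_of_nonneg (sqrt_nonneg _)]
    refine mul_inv_le_one_of_le₀ (le_sqrt_of_sq_le ?_) (sqrt_nonneg _)
    nlinarith [mul_pos hs0 hs0]
  · exact MeasureTheory.integrableOn_const (by simp) (by simp)
  · filter_upwards [MeasureTheory.ae_restrict_mem measurableSet_Ioo] with θ hθ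
    have hs := sin_pos_of_mem_Ioo hθ
    rcases (sin_le_one θ).eq_or_lt with h | h
    · simp [h]
    · have h1 : 0 < 1 - 1 * sin θ ^ 2 := by nlinarith
      have h2 : ContinuousAt (fun x : ℝ => (1 - sin θ) * (√(1 - x * sin θ ^ 2))⁻¹) 1 :=
        continuousAt_const.mul (ContinuousAt.inv₀ (by fun_prop) (sqrt_pos.2 h1).ne')
      have h3 := h2.tendsto.mono_left (nhdsWithin_le_nhds (s := Set.Iio 1))
      simpa using h3

theorem tendsto_integral_sin_div_sqrt :
    Tendsto (fun x : ℝ => (∫ θ in Set.Ioo 0 π, sin θ * (√(1 - x * sin θ ^ 2))⁻¹) + log (1 - x))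
      (nhdsWithin 1 (Set.Iio 1)) (nhds (2 * log 2)) := by
  have h1 : Tendsto (fun x : ℝ => 1 - x) (nhdsWithin 1 (Set.Iio 1)) (nhdsWithin 0 (Set.Ioi 0)) := by
    refine tendsto_nhdsWithin_iff.2 ⟨?_, ?_⟩
    · have : ContinuousAt (fun x : ℝ => 1 - x) 1 := by fun_prop
      simpa using this.tendsto.mono_left (nhdsWithin_le_nhds (s := Set.Iio 1))
    · filter_upwards [self_mem_nhdsWithin] with x hx
      simpa using hx
  -- The leftover `log (1 - x) (1 - 1/√x)` is `(1 - x) log (1 - x)` times a bounded factor near `1`,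
  -- up to sign, hence tends to `0`.
  have h2 := (tendsto_log_mul_rpow_nhdsGT_zero one_pos).comp h1
  have h3 : Tendsto (fun x : ℝ => (√x * (1 + √x))⁻¹) (nhdsWithin 1 (Set.Iio 1))
      (nhds (√1 * (1 + √1))⁻¹) := by
    refine Tendsto.mono_left (ContinuousAt.tendsto ?_) nhdsWithin_le_nhds
    exact ContinuousAt.inv₀ (by fun_prop) (by simp)
  have h4 : Tendsto (fun x : ℝ => 2 * log (1 + √x) / √x) (nhdsWithin 1 (Set.Iio 1))
      (nhds (2 * log (1 + √1) / √1)) := by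
    refine Tendsto.mono_left (ContinuousAt.tendsto ?_) nhdsWithin_le_nhds
    refine ContinuousAt.div (ContinuousAt.mul continuousAt_const (ContinuousAt.log (by fun_prop) ?_))
      (by fun_prop) (by simp)
    simp
  have h5 := h4.sub (h2.mul h3)
  rw [sqrt_one, zero_mul, sub_zero, div_one, one_add_one_eq_two] at h5
  refine h5.congr' ?_
  filter_upwards [self_mem_nhdsWithin,
    nhdsWithin_le_nhds (Ioi_mem_nhds (zero_lt_one (α := ℝ)))] with x hx1 hx0
  have hx0' : 0 < x := hx0
  rw [integral_sin_div_sqrt hx0' hx1]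
  simp only [Function.comp, rpow_one]
  have hy : 0 < √x := sqrt_pos.2 hx0'
  have hyx : √x ^ 2 = x := sq_sqrt hx0'.le
  field_simp
  linear_combination (-log (1 - x)) * hyx

/-- Splitting `1 = sin θ + (1 - sin θ)` isolates the divergence in an elementary integral; each part
contributes `2 log 2`. -/
theorem tendsto_integral_inv_sqrt :
    Tendsto (fun x : ℝ => (∫ θ in Set.Ioo 0 π, (√(1 - x * sin θ ^ 2))⁻¹) + log (1 - x))
      (nhdsWithin 1 (Set.Iio 1)) (nhds (log 16)) := by
  have h := tendsto_integral_sin_div_sqrt.add tendsto_integral_one_sub_sin_div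
  have e : 2 * log 2 + 2 * log 2 = log 16 := by
    rw [show (16 : ℝ) = 2 ^ 4 by norm_num, log_pow]
    push_cast
    ring
  rw [e] at h
  refine h.congr' ?_
  filter_upwards [self_mem_nhdsWithin,
    nhdsWithin_le_nhds (Ioi_mem_nhds (zero_lt_one (α := ℝ)))] with x hx1 hx0
  have hx0' : 0 < x := hx0
  have hx1' : x < 1 := hx1
  have hpos : ∀ θ, 0 < 1 - x * sin θ ^ 2 := fun θ => by
    nlinarith [sin_sq_le_one θ, sq_nonneg (sin θ)]
  have hc : Continuous fun θ => (√(1 - x * sin θ ^ 2))⁻¹ :=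
    (by fun_prop : Continuous fun θ => √(1 - x * sin θ ^ 2)).inv₀
      fun θ => (sqrt_pos.2 (hpos θ)).ne'
  have hint : ∀ f : ℝ → ℝ, Continuous f → MeasureTheory.IntegrableOn
      (fun θ => f θ * (√(1 - x * sin θ ^ 2))⁻¹) (Set.Ioo 0 π) := fun f hf =>
    ((hf.mul hc).continuousOn.integrableOn_Icc).mono_set Set.Ioo_subset_Icc_self
  rw [add_right_comm, ← MeasureTheory.integral_add (hint _ continuous_sin)
    (hint (fun θ => 1 - sin θ) (by fun_prop))]
  congr 2
  funext θ
  ring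

theorem landauConst_succ (n : ℕ) :
    landauConst (n + 1) = landauConst n + wallisCoeff (n + 1) ^ 2 :=
  Finset.sum_range_succ _ _

theorem landauConst_zero : landauConst 0 = 1 := by simp [landauConst]

theorem sum_wallisCoeff_sub (n : ℕ) :
    ∑ k ∈ Finset.range (n + 1), (π * wallisCoeff k ^ 2 - (k : ℝ)⁻¹) =
      π * landauConst n - harmonic n := by
  induction n with
  | zero => simp [landauConst_zero, wallisCoeff]
  | succ n ih =>
    rw [Finset.sum_range_succ, ih, landauConst_succ, harmonic_succ]
    push_cast
    ring

theorem eq_of_tendsto_landauConst_sub_log {C : ℝ}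
    (h : Tendsto (fun n : ℕ => π * landauConst n - log (n + 1)) atTop (nhds C)) :
    C = log 16 + eulerMascheroniConstant := by
  -- The convention `0⁻¹ = 0` lets the harmonic term at `k = 0` drop out. Abel's theorem then
  -- equates this limit with that of the power series as `x → 1⁻`.
  have h1 : Tendsto (fun n : ℕ => ∑ k ∈ Finset.range (n + 1), (π * wallisCoeff k ^ 2 - (k : ℝ)⁻¹))
      atTop (nhds (C - eulerMascheroniConstant)) := by
    refine (h.sub tendsto_harmonic_sub_log_add_one).congr fun n => ?_
    rw [sum_wallisCoeff_sub]
    ring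
  have h2 := Real.tendsto_tsum_powerSeries_nhdsWithin_lt ((tendsto_add_atTop_iff_nat 1).1 h1)
  have h3 : C - eulerMascheroniConstant = log 16 := by
    refine tendsto_nhds_unique h2 (tendsto_integral_inv_sqrt.congr' ?_)
    filter_upwards [self_mem_nhdsWithin,
      nhdsWithin_le_nhds (Ioi_mem_nhds (zero_lt_one (α := ℝ)))] with x hx1 hx0
    have hx0' : 0 < x := hx0
    have hx1' : x < 1 := hx1
    have e1 := hasSum_wallisCoeff_sq hx0' hx1'
    have e2 : HasSum (fun n : ℕ => (n : ℝ)⁻¹ * x ^ n) (-log (1 - x)) := by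
      rw [← hasSum_nat_add_iff' 1]
      have e3 := hasSum_pow_div_log_of_abs_lt_one (x := x) (by rwa [abs_of_pos hx0'])
      have e4 : -log (1 - x) - ∑ i ∈ Finset.range 1, (i : ℝ)⁻¹ * x ^ i = -log (1 - x) := by simp
      rw [e4]
      refine e3.congr_fun fun n => ?_
      push_cast
      ring
    rw [← sub_neg_eq_add, ← (e1.sub e2).tsum_eq]
    congr 1
    funext n
    ring
  linarith

/-! ### The Laplace representation of the Landau constants -/

theorem integrableOn_exp_mul_pow {x : ℝ} (hx : 0 < x) (k : ℕ) :
    MeasureTheory.IntegrableOn (fun t => exp (-(x * t)) * t ^ k) (Set.Ioi 0) := by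
  have := integrableOn_rpow_mul_exp_neg_mul_rpow (s := (k : ℝ)) (p := 1) (b := x)
    (by have : (0 : ℝ) ≤ k := Nat.cast_nonneg k
        linarith) one_pos hx
  simp only [rpow_one, neg_mul, rpow_natCast] at this
  simpa only [mul_comm] using this

theorem integral_exp_mul_pow {x : ℝ} (hx : 0 < x) (k : ℕ) :
    ∫ t in Set.Ioi (0 : ℝ), exp (-(x * t)) * t ^ k = k.factorial / x ^ (k + 1) := by
  have := integral_rpow_mul_exp_neg_mul_Ioi (a := (k : ℝ) + 1) (r := x) (by positivity) hx
  rw [Gamma_nat_eq_factorial, add_sub_cancel_right] at this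
  simp only [rpow_natCast] at this
  simp_rw [mul_comm (exp _)]
  rw [this, one_div, inv_rpow hx.le, ← Nat.cast_add_one, rpow_natCast]
  field_simp

theorem integrableOn_exp_mul {x A B : ℝ} {k j : ℕ} {h : ℝ → ℝ} (hx : 0 < x)
    (hc : ContinuousOn h (Set.Ioi 0)) (hb : ∀ t, 0 < t → |h t| ≤ A * t ^ k + B * t ^ j) :
    MeasureTheory.IntegrableOn (fun t => exp (-(x * t)) * h t) (Set.Ioi 0) := by
  refine MeasureTheory.Integrable.mono' (((integrableOn_exp_mul_pow hx k).const_mul A).add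
    ((integrableOn_exp_mul_pow hx j).const_mul B)) ?_ ?_
  · exact (ContinuousOn.mul (by fun_prop) hc).aestronglyMeasurable measurableSet_Ioi
  · filter_upwards [MeasureTheory.ae_restrict_mem measurableSet_Ioi] with t ht
    rw [norm_mul, norm_of_nonneg (exp_pos _).le, norm_eq_abs]
    have := mul_le_mul_of_nonneg_left (hb t ht) (exp_pos (-(x * t))).le
    simp only [Pi.add_apply]
    linarith

theorem abs_integral_exp_mul_le {x A B : ℝ} {k j : ℕ} {h : ℝ → ℝ} (hx : 0 < x)
    (hb : ∀ t, 0 < t → |h t| ≤ A * t ^ k + B * t ^ j) :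
    |∫ t in Set.Ioi (0 : ℝ), exp (-(x * t)) * h t| ≤
      A * (k.factorial / x ^ (k + 1)) + B * (j.factorial / x ^ (j + 1)) := by
  have i1 := (integrableOn_exp_mul_pow hx k).const_mul A
  have i2 := (integrableOn_exp_mul_pow hx j).const_mul B
  have h1 := MeasureTheory.norm_integral_le_of_norm_le
    (μ := MeasureTheory.volume.restrict (Set.Ioi 0)) (f := fun t => exp (-(x * t)) * h t)
    (i1.add i2) ?_
  · refine h1.trans (le_of_eq ?_)
    simp only [Pi.add_apply]
    rw [MeasureTheory.integral_add i1 i2, MeasureTheory.integral_const_mul,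
      MeasureTheory.integral_const_mul, integral_exp_mul_pow hx, integral_exp_mul_pow hx]
  · filter_upwards [MeasureTheory.ae_restrict_mem measurableSet_Ioi] with t ht
    rw [norm_mul, norm_of_nonneg (exp_pos _).le, norm_eq_abs]
    have := mul_le_mul_of_nonneg_left (hb t ht) (exp_pos (-(x * t))).le
    simp only [Pi.add_apply]
    linarith

/-- The function whose Laplace transform at `n + 1` is `π G_n - log (16 (n + 1)) - γ`. -/
noncomputable def landauBorel (t : ℝ) : ℝ :=
  (1 - legF (t ^ 2 / 16)) / t - legQ (t ^ 2 / 16) / 4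

theorem smoothCM_legF : SmoothCM legF := cm_legF.smoothCM (by norm_num)

theorem smoothCM_legQ : SmoothCM legQ := cm_legQ.smoothCM (by norm_num)

/-- With `u = t/4` this is `exp (-u) / (1 - exp (-4u)) = (1 / sinh u + 1 / cosh u) / 4`. It makes
the first difference of the Laplace transform computable. -/
theorem one_sub_exp_neg_mul_landauBorel {t : ℝ} (ht : 0 < t) :
    (1 - exp (-t)) * landauBorel t = (1 - exp (-t)) / t - exp (-(t / 4)) * legP (t ^ 2 / 16) := by
  obtain ⟨u, hu⟩ : ∃ u, u = t / 4 := ⟨_, rfl⟩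
  have hu0 : 0 < u := by rw [hu]; positivity
  have htu : t = 4 * u := by rw [hu]; ring
  have hz : t ^ 2 / 16 = u ^ 2 := by rw [htu]; ring
  have hs : 0 < sinh u := sinh_pos_iff.2 hu0
  have hc : 0 < cosh u := cosh_pos u
  have e1 : shc (u ^ 2) = sinh u / u := by
    rw [eq_div_iff hu0.ne', mul_comm]; exact mul_shc_sq u
  have e2 : shc (4 * u ^ 2) = sinh u * cosh u / u := by
    have := mul_shc_sq (2 * u)
    rw [sinh_two_mul, mul_pow] at this
    norm_num at this
    rw [eq_div_iff hu0.ne']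
    linear_combination this / 2
  have e3 : (1 - exp (-t)) * (cosh u + sinh u) = 4 * (sinh u * cosh u) * exp (-u) := by
    rw [cosh_add_sinh, sinh_eq, cosh_eq, htu, show -(4 * u) = -u + -u + -u + -u by ring,
      exp_add, exp_add, exp_add]
    have : exp u * exp (-u) = 1 := by rw [← exp_add]; simp
    linear_combination (-exp (-u) ^ 3 - exp u) * this
  rw [landauBorel, hz, legF, legQ, e1, e2, ← hu]
  rw [htu] at e3 ⊢
  generalize legP (u ^ 2) = p
  generalize exp (-(4 * u)) = q at *
  field_simp
  linear_combination (-(p * u)) * e3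

theorem one_sub_legF_le {z : ℝ} (hz : 0 ≤ z) : 1 - legF z ≤ altCoeff legF 1 * z := by
  have h := smoothCM_legF.altRem_le 1 hz
  rw [altRem_succ, altRem_zero] at h
  simpa [altCoeff, legF_zero] using h

theorem legF_le_one {z : ℝ} (hz : 0 ≤ z) : legF z ≤ 1 := by
  rw [← legF_zero]
  exact cm_legF.antitone (by norm_num) hz

theorem legQ_le_one {z : ℝ} (hz : 0 ≤ z) : legQ z ≤ 1 := by
  have h : legQ 0 = 1 := by simp [legQ, legP_zero, shc_zero]
  rw [← h]
  exact cm_legQ.antitone (by norm_num) hz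

theorem abs_landauBorel_le {t : ℝ} (ht : 0 < t) :
    |landauBorel t| ≤ 1 / 4 * t ^ 0 + altCoeff legF 1 / 16 * t ^ 1 := by
  have hz : 0 ≤ t ^ 2 / 16 := by positivity
  have h1 := one_sub_legF_le hz
  have h2 := legF_le_one hz
  have h3 := legQ_le_one hz
  have h4 := cm_legQ.nonneg (z := t ^ 2 / 16) (by linarith)
  have h5 : 0 ≤ (1 - legF (t ^ 2 / 16)) / t := div_nonneg (by linarith) ht.le
  have h6 : (1 - legF (t ^ 2 / 16)) / t ≤ altCoeff legF 1 / 16 * t := by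
    rw [div_le_iff₀ ht]
    linarith
  rw [landauBorel, pow_zero, pow_one, abs_le]
  constructor <;> linarith

theorem continuousOn_comp_sq_div {f : ℝ → ℝ} (hf : ContinuousOn f (Set.Ici 0)) :
    ContinuousOn (fun t : ℝ => f (t ^ 2 / 16)) (Set.Ioi 0) :=
  hf.comp (by fun_prop) fun t _ => Set.mem_Ici.2 (by positivity)

theorem continuousOn_landauBorel : ContinuousOn landauBorel (Set.Ioi 0) := by
  have h1 : ContinuousOn legF (Set.Ici 0) :=
    cm_legF.continuousOn.mono fun z hz => Set.mem_Ioi.2 (lt_of_lt_of_le neg_one_lt_zero (Set.mem_Ici.1 hz))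
  have h2 : ContinuousOn legQ (Set.Ici 0) :=
    cm_legQ.continuousOn.mono fun z hz => Set.mem_Ioi.2 (lt_of_lt_of_le neg_one_lt_zero (Set.mem_Ici.1 hz))
  exact ((continuousOn_const.sub (continuousOn_comp_sq_div h1)).div continuousOn_id
    fun t ht => ne_of_gt ht).sub ((continuousOn_comp_sq_div h2).div_const 4)

/-- The Laplace transform of `landauBorel`. -/
noncomputable def landauLaplace (x : ℝ) : ℝ :=
  ∫ t in Set.Ioi (0 : ℝ), exp (-(x * t)) * landauBorel t

theorem integral_frullani_exp {x : ℝ} (hx : 0 < x) :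
    MeasureTheory.IntegrableOn (fun t => exp (-(x * t)) * ((1 - exp (-t)) / t)) (Set.Ioi 0) ∧
    ∫ t in Set.Ioi (0 : ℝ), exp (-(x * t)) * ((1 - exp (-t)) / t) = log ((x + 1) / x) := by
  have hint : MeasureTheory.IntegrableOn
      (fun t => exp (-(x * t)) * ((1 - exp (-t)) / t)) (Set.Ioi 0) := by
    refine integrableOn_exp_mul (A := 1) (B := 0) (k := 0) (j := 0) hx ?_ fun t ht => ?_
    · exact ContinuousOn.div (by fun_prop) (by fun_prop) fun t ht => ne_of_gt ht
    · have h1 : exp (-t) ≤ 1 := exp_le_one_iff.2 (by linarith)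
      have h2 := add_one_le_exp (-t)
      rw [abs_of_nonneg (div_nonneg (by linarith) ht.le)]
      have : (1 - exp (-t)) / t ≤ 1 := by rw [div_le_one ht]; linarith
      simpa using this
  refine ⟨hint, ?_⟩
  have e : ∀ t, t⁻¹ • (exp (-(x * t)) - exp (-((x + 1) * t))) =
      exp (-(x * t)) * ((1 - exp (-t)) / t) := by
    intro t
    rw [add_mul, neg_add, exp_add, one_mul, smul_eq_mul]
    ring
  have h := Frullani.integral_Ioi_eq (f := fun t => exp (-t)) (a := x) (b := x + 1) (L := 1) (R := 0)
    ((by fun_prop : Continuous fun t : ℝ => exp (-t)).locallyIntegrable.locallyIntegrableOn _) hx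
    (by linarith) ?_ ?_ ?_
  · simp only [e] at h
    simpa using h
  · have : ContinuousAt (fun t : ℝ => exp (-t)) 0 := by fun_prop
    simpa using this.tendsto.mono_left (nhdsWithin_le_nhds (s := Set.Ioi 0))
  · exact tendsto_exp_neg_atTop_nhds_zero
  · simp only [e]
    exact hint

/-- The difference inserts the factor `1 - exp (-t)`; one resulting term is a Frullani integral, the
other is the transform of `legP (t²/16)` at `(n + 1) + 1/4`. -/
theorem landauLaplace_sub (n : ℕ) :
    landauLaplace (n + 1) - landauLaplace (n + 1 + 1) =
      log (((n : ℝ) + 1 + 1) / (n + 1)) - π * wallisCoeff (n + 1) ^ 2 := by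
  have hx : (0 : ℝ) < n + 1 := by positivity
  have i1 := integrableOn_exp_mul hx continuousOn_landauBorel fun t ht => abs_landauBorel_le ht
  have i2 := integrableOn_exp_mul (x := (n : ℝ) + 1 + 1) (by positivity)
    continuousOn_landauBorel fun t ht => abs_landauBorel_le ht
  obtain ⟨i3, hF⟩ := integral_frullani_exp hx
  have i4 : MeasureTheory.IntegrableOn (fun t => exp (-((((n + 1 : ℕ) : ℝ) + 1 / 4) * t)) *
      legP (t ^ 2 / 16)) (Set.Ioi 0) := by
    refine integrableOn_exp_mul (A := 1) (B := 0) (k := 0) (j := 0) (by positivity)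
      (continuousOn_comp_sq_div (cm_legP.continuousOn.mono
        fun z hz => Set.mem_Ioi.2 (lt_of_lt_of_le neg_one_lt_zero (Set.mem_Ici.1 hz)))) fun t _ => ?_
    have hz : 0 ≤ t ^ 2 / 16 := by positivity
    rw [abs_of_pos (legP_pos (by linarith))]
    simpa using legP_le_one hz
  rw [landauLaplace, landauLaplace, ← MeasureTheory.integral_sub i1 i2, ← hF,
    ← integral_exp_mul_legP, ← MeasureTheory.integral_sub i3 i4]
  refine MeasureTheory.setIntegral_congr_fun measurableSet_Ioi fun t ht => ?_
  have h := one_sub_exp_neg_mul_landauBorel ht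
  have e1 : exp (-(((n : ℝ) + 1 + 1) * t)) = exp (-(((n : ℝ) + 1) * t)) * exp (-t) := by
    rw [← exp_add]; ring_nf
  have e2 : exp (-((((n + 1 : ℕ) : ℝ) + 1 / 4) * t)) =
      exp (-(((n : ℝ) + 1) * t)) * exp (-(t / 4)) := by
    rw [← exp_add]; push_cast; ring_nf
  rw [e1, e2]
  linear_combination exp (-(((n : ℝ) + 1) * t)) * h

theorem tendsto_landauLaplace : Tendsto (fun n : ℕ => landauLaplace (n + 1)) atTop (nhds 0) := by
  have hb : ∀ n : ℕ, ‖landauLaplace (n + 1)‖ ≤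
      (1 / 4 + altCoeff legF 1 / 16) * (1 / ((n : ℝ) + 1)) := by
    intro n
    have hx : (0 : ℝ) < n + 1 := by positivity
    have h := abs_integral_exp_mul_le hx fun t ht => abs_landauBorel_le ht
    have h2 : 1 / ((n : ℝ) + 1) ^ 2 ≤ 1 / ((n : ℝ) + 1) := by
      have : (0 : ℝ) ≤ n := Nat.cast_nonneg n
      exact one_div_le_one_div_of_le hx (by nlinarith)
    have h3 := smoothCM_legF.altCoeff_nonneg 1
    refine h.trans ?_
    norm_num at h2 ⊢
    nlinarith
  refine squeeze_zero_norm hb ?_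
  simpa using (tendsto_one_div_add_atTop_nhds_zero_nat (𝕜 := ℝ)).const_mul
    (1 / 4 + altCoeff legF 1 / 16)

theorem landauConst_eq (n : ℕ) :
    π * landauConst n = log (16 * ((n : ℝ) + 1)) + eulerMascheroniConstant +
      landauLaplace (n + 1) := by
  -- The Landau constants less `log (n + 1)` and the Laplace transform have equal increments, so
  -- only a constant remains; decay of the transform identifies it.
  have hconst : ∀ n : ℕ, π * landauConst n - log (n + 1) - landauLaplace (n + 1) =
      π - landauLaplace 1 := by
    intro n
    induction n with
    | zero => simp [landauConst_zero]
    | succ n ih =>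
      have h1 := landauLaplace_sub n
      have hx : (0 : ℝ) < n + 1 := by positivity
      rw [log_div (by positivity) hx.ne'] at h1
      rw [landauConst_succ]
      push_cast
      linarith
  have hC : π - landauLaplace 1 = log 16 + eulerMascheroniConstant := by
    refine eq_of_tendsto_landauConst_sub_log ?_
    have := tendsto_landauLaplace.add_const (π - landauLaplace 1)
    rw [zero_add] at this
    refine this.congr fun n => ?_
    rw [← hconst n]
    ring
  have hx : (0 : ℝ) < n + 1 := by positivity
  have := hconst n
  rw [hC] at this
  rw [log_mul (by norm_num) hx.ne']
  linarith

/-! ### Taylor remainders and the asymptotic expansion -/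

/-- The Taylor coefficients of `landauBorel` at `0`. -/
noncomputable def borelCoeff (i : ℕ) : ℝ :=
  if Even i then -((-1) ^ (i / 2) * altCoeff legQ (i / 2) / 16 ^ (i / 2) / 4)
  else (-1) ^ (i / 2) * altCoeff legF (i / 2 + 1) / 16 ^ (i / 2 + 1)

theorem borelCoeff_even (m : ℕ) :
    borelCoeff (2 * m) = -((-1) ^ m * altCoeff legQ m / 16 ^ m / 4) := by
  simp [borelCoeff]

theorem borelCoeff_odd (m : ℕ) :
    borelCoeff (2 * m + 1) = (-1) ^ m * altCoeff legF (m + 1) / 16 ^ (m + 1) := by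
  have h : (2 * m + 1) / 2 = m := by omega
  simp [borelCoeff, h]

/-- The `l`-th Taylor remainder of `landauBorel` at `0`. -/
noncomputable def borelRem (l : ℕ) (t : ℝ) : ℝ :=
  landauBorel t - ∑ i ∈ Finset.range l, borelCoeff i * t ^ i

theorem borelRem_succ (l : ℕ) (t : ℝ) :
    borelRem (l + 1) t = borelRem l t - borelCoeff l * t ^ l := by
  simp only [borelRem, Finset.sum_range_succ]
  ring

/-- In `t`, the `legF` part is odd and the `legQ` part even, so each new order advances only one of
the two remainders. Their relative sign is therefore adverse for even `l` and favourable for odd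
`l`. -/
theorem borelRem_even_and_odd (m : ℕ) {t : ℝ} (ht : 0 < t) :
    borelRem (2 * m) t = (-1) ^ m * (altRem legF (m + 1) (t ^ 2 / 16) / t -
      altRem legQ m (t ^ 2 / 16) / 4) ∧
    borelRem (2 * m + 1) t = (-1) ^ m * (altRem legF (m + 1) (t ^ 2 / 16) / t +
      altRem legQ (m + 1) (t ^ 2 / 16) / 4) := by
  have hodd : ∀ m, borelRem (2 * m) t = (-1) ^ m * (altRem legF (m + 1) (t ^ 2 / 16) / t -
      altRem legQ m (t ^ 2 / 16) / 4) →
      borelRem (2 * m + 1) t = (-1) ^ m * (altRem legF (m + 1) (t ^ 2 / 16) / t +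
      altRem legQ (m + 1) (t ^ 2 / 16) / 4) := by
    intro m h
    rw [borelRem_succ, h, borelCoeff_even, altRem_succ legQ, div_pow, ← pow_mul]
    field_simp
    ring
  have heven : borelRem (2 * m) t = (-1) ^ m * (altRem legF (m + 1) (t ^ 2 / 16) / t -
      altRem legQ m (t ^ 2 / 16) / 4) := by
    induction m with
    | zero =>
      simp [borelRem, landauBorel, altRem_succ legF, altRem_zero, altCoeff, legF_zero]
    | succ m ih =>
      rw [show 2 * (m + 1) = 2 * m + 1 + 1 by ring, borelRem_succ, hodd m ih, borelCoeff_odd,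
        altRem_succ legF (m + 1), div_pow, ← pow_mul]
      field_simp
      ring
  exact ⟨heven, hodd m heven⟩

theorem continuousOn_borelRem (l : ℕ) : ContinuousOn (borelRem l) (Set.Ioi 0) :=
  continuousOn_landauBorel.sub (by fun_prop)

theorem altRem_comp_le {f : ℝ → ℝ} (hf : SmoothCM f) (m : ℕ) (t : ℝ) :
    altRem f m (t ^ 2 / 16) ≤ altCoeff f m / 16 ^ m * t ^ (2 * m) := by
  refine (hf.altRem_le m (by positivity)).trans (le_of_eq ?_)
  rw [div_pow, ← pow_mul]
  ring

theorem altRem_comp_div_le {f : ℝ → ℝ} (hf : SmoothCM f) (m : ℕ) {t : ℝ} (ht : 0 < t) :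
    altRem f (m + 1) (t ^ 2 / 16) / t ≤ altCoeff f (m + 1) / 16 ^ (m + 1) * t ^ (2 * m + 1) := by
  rw [div_le_iff₀ ht]
  refine (altRem_comp_le hf (m + 1) t).trans (le_of_eq ?_)
  ring

theorem exists_abs_borelRem_le (l : ℕ) : ∃ A B : ℝ, 0 ≤ A ∧ 0 ≤ B ∧ ∀ t, 0 < t →
    |borelRem l t| ≤ A * t ^ l + B * t ^ (l + 1) := by
  obtain ⟨m, rfl | rfl⟩ := Nat.even_or_odd' l
  · refine ⟨altCoeff legQ m / 16 ^ m / 4, altCoeff legF (m + 1) / 16 ^ (m + 1),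
      div_nonneg (div_nonneg (smoothCM_legQ.altCoeff_nonneg _) (by positivity)) (by norm_num),
      div_nonneg (smoothCM_legF.altCoeff_nonneg _) (by positivity), fun t ht => ?_⟩
    have h1 := altRem_comp_le smoothCM_legQ m t
    have h2 := altRem_comp_div_le smoothCM_legF m ht
    have h3 := smoothCM_legQ.altRem_nonneg m (z := t ^ 2 / 16) (by positivity)
    have h4 := div_nonneg (smoothCM_legF.altRem_nonneg (m + 1) (z := t ^ 2 / 16) (by positivity))
      ht.le
    rw [(borelRem_even_and_odd m ht).1, abs_mul, abs_pow, abs_neg, abs_one, one_pow, one_mul, abs_le]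
    constructor <;> linarith
  · refine ⟨altCoeff legF (m + 1) / 16 ^ (m + 1), altCoeff legQ (m + 1) / 16 ^ (m + 1) / 4,
      div_nonneg (smoothCM_legF.altCoeff_nonneg _) (by positivity),
      div_nonneg (div_nonneg (smoothCM_legQ.altCoeff_nonneg _) (by positivity)) (by norm_num),
      fun t ht => ?_⟩
    have h1 := altRem_comp_le smoothCM_legQ (m + 1) t
    have h2 := altRem_comp_div_le smoothCM_legF m ht
    have h3 := smoothCM_legQ.altRem_nonneg (m + 1) (z := t ^ 2 / 16) (by positivity)
    have h4 := div_nonneg (smoothCM_legF.altRem_nonneg (m + 1) (z := t ^ 2 / 16) (by positivity))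
      ht.le
    rw [(borelRem_even_and_odd m ht).2, abs_mul, abs_pow, abs_neg, abs_one, one_pow, one_mul, abs_le,
      show 2 * m + 1 + 1 = 2 * (m + 1) by ring]
    constructor <;> linarith

/-- The coefficients of the asymptotic expansion of the Landau constants. -/
noncomputable def landauAlpha (k : ℕ) : ℝ := (k - 1).factorial * borelCoeff (k - 1)

theorem integrableOn_exp_mul_borelRem {x : ℝ} (hx : 0 < x) (l : ℕ) :
    MeasureTheory.IntegrableOn (fun t => exp (-(x * t)) * borelRem l t) (Set.Ioi 0) := by
  obtain ⟨A, B, -, -, h⟩ := exists_abs_borelRem_le l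
  exact integrableOn_exp_mul hx (continuousOn_borelRem l) h

/-- Watson's lemma in exact form: removing `borelCoeff l * t ^ l` from the integrand removes `l!
borelCoeff l / N ^ (l + 1)` from the integral. -/
theorem granathError_landauAlpha (l n : ℕ) :
    granathError landauAlpha l n =
      ∫ t in Set.Ioi (0 : ℝ), exp (-(((n : ℝ) + 1) * t)) * borelRem l t := by
  have hx : (0 : ℝ) < n + 1 := by positivity
  induction l with
  | zero =>
    simp [granathError, granathTrunc, landauConst_eq, landauLaplace, borelRem]
  | succ l ih =>
    have i1 := integrableOn_exp_mul_borelRem hx l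
    have i2 := (integrableOn_exp_mul_pow hx l).const_mul (borelCoeff l)
    have e : ∀ t, exp (-(((n : ℝ) + 1) * t)) * borelRem (l + 1) t =
        exp (-(((n : ℝ) + 1) * t)) * borelRem l t -
          borelCoeff l * (exp (-(((n : ℝ) + 1) * t)) * t ^ l) := fun t => by
      rw [borelRem_succ]; ring
    simp_rw [e]
    rw [MeasureTheory.integral_sub i1 i2, ← ih, MeasureTheory.integral_const_mul,
      integral_exp_mul_pow hx]
    simp only [granathError, granathTrunc, Finset.sum_Icc_succ_top (Nat.le_add_left 1 l),
      landauAlpha, Nat.add_sub_cancel]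
    ring

theorem isGranathExpansion_landauAlpha : IsGranathExpansion landauAlpha := by
  intro l
  obtain ⟨A, B, hA, hB, h⟩ := exists_abs_borelRem_le l
  set C := A * l.factorial + B * (l + 1).factorial with hC
  have hbound : ∀ n : ℕ, ‖granathError landauAlpha l n‖ ≤
      C * ‖1 / ((n : ℝ) + 1) ^ (l + 1)‖ := by
    intro n
    have hx : (0 : ℝ) < n + 1 := by positivity
    have h1 : (1 : ℝ) ≤ n + 1 := by have : (0 : ℝ) ≤ n := Nat.cast_nonneg n
                                    linarith
    rw [granathError_landauAlpha, norm_of_nonneg (by positivity : 0 ≤ 1 / ((n : ℝ) + 1) ^ (l + 1)),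
      norm_eq_abs]
    refine (abs_integral_exp_mul_le hx h).trans ?_
    have h2 : ((l + 1).factorial : ℝ) / ((n : ℝ) + 1) ^ (l + 1 + 1) ≤
        (l + 1).factorial / ((n : ℝ) + 1) ^ (l + 1) := by
      gcongr
      omega
    calc _ ≤ A * (l.factorial / ((n : ℝ) + 1) ^ (l + 1)) +
          B * ((l + 1).factorial / ((n : ℝ) + 1) ^ (l + 1)) := by gcongr
      _ = _ := by rw [hC]; ring
  refine (IsBigO.of_bound C (Eventually.of_forall hbound)).trans_isLittleO ?_
  have h0 : Tendsto (fun n : ℕ => 1 / ((n : ℝ) + 1)) atTop (nhds 0) :=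
    tendsto_one_div_add_atTop_nhds_zero_nat
  have h1 := (isLittleO_one_iff ℝ).2 h0
  have h2 := h1.mul_isBigO (isBigO_refl (fun n : ℕ => 1 / ((n : ℝ) + 1) ^ l) atTop)
  refine (h2.congr (fun n => ?_) fun n => one_mul _)
  rw [pow_succ]
  field_simp

theorem IsGranathExpansion.eq {α β : ℕ → ℝ} (hα : IsGranathExpansion α)
    (hβ : IsGranathExpansion β) (k : ℕ) (hk : 1 ≤ k) : α k = β k := by
  induction k using Nat.strong_induction_on with
  | _ k ih =>
    obtain ⟨l, rfl⟩ : ∃ l, k = l + 1 := ⟨k - 1, by omega⟩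
    have h := (hα (l + 1)).sub (hβ (l + 1))
    have e : ∀ n : ℕ, granathError α (l + 1) n - granathError β (l + 1) n =
        (β (l + 1) - α (l + 1)) * (1 / ((n : ℝ) + 1) ^ (l + 1)) := by
      intro n
      have h1 : ∑ k ∈ Finset.Icc 1 l, α k / ((n : ℝ) + 1) ^ k =
          ∑ k ∈ Finset.Icc 1 l, β k / ((n : ℝ) + 1) ^ k := by
        refine Finset.sum_congr rfl fun k hk => ?_
        rw [Finset.mem_Icc] at hk
        rw [ih k (by omega) hk.1]
      simp only [granathError, granathTrunc, Finset.sum_Icc_succ_top (Nat.le_add_left 1 l), h1]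
      ring
    simp_rw [e] at h
    by_contra hne
    have h2 := (isLittleO_const_mul_left_iff (sub_ne_zero.2 (Ne.symm hne))).1 h
    obtain ⟨n, hn⟩ := (h2.def (c := 1 / 2) (by norm_num)).exists
    have h3 : 0 < ‖1 / ((n : ℝ) + 1) ^ (l + 1)‖ := norm_pos_iff.2 (by positivity)
    linarith

theorem granathError_congr {α β : ℕ → ℝ} (h : ∀ k, 1 ≤ k → α k = β k) (l n : ℕ) :
    granathError α l n = granathError β l n := by
  simp only [granathError, granathTrunc]
  congr 2
  refine Finset.sum_congr rfl fun k hk => ?_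
  rw [h k (Finset.mem_Icc.1 hk).1]

/-! ### Signs of the truncation errors -/

theorem integral_Ioi_pos {f : ℝ → ℝ} (hf : ∀ t, 0 < t → 0 < f t)
    (hi : MeasureTheory.IntegrableOn f (Set.Ioi 0)) : 0 < ∫ t in Set.Ioi (0 : ℝ), f t := by
  rw [MeasureTheory.setIntegral_pos_iff_support_of_nonneg_ae _ hi]
  · have : Set.Ioi (0 : ℝ) ⊆ Function.support f ∩ Set.Ioi 0 := fun t ht => ⟨(hf t ht).ne', ht⟩
    exact lt_of_lt_of_le (by simp) (MeasureTheory.measure_mono this)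
  · filter_upwards [MeasureTheory.ae_restrict_mem measurableSet_Ioi] with t ht using (hf t ht).le

theorem altRem_legF_pos (m : ℕ) {t : ℝ} (ht : 0 < t) :
    0 < altRem legF (m + 1) (t ^ 2 / 16) / t :=
  div_pos (smoothCM_legF.altRem_pos (fun _ => legF_pos) tendsto_legF _ (by positivity)) ht

theorem granathError_odd (m n : ℕ) :
    0 < (-1) ^ m * granathError landauAlpha (2 * m + 1) n := by
  have hx : (0 : ℝ) < n + 1 := by positivity
  rw [granathError_landauAlpha, ← MeasureTheory.integral_const_mul]
  refine integral_Ioi_pos (fun t ht => ?_) ((integrableOn_exp_mul_borelRem hx _).const_mul _)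
  have h1 := altRem_legF_pos m ht
  have h2 := smoothCM_legQ.altRem_nonneg (m + 1) (z := t ^ 2 / 16) (by positivity)
  rw [(borelRem_even_and_odd m ht).2, mul_left_comm, ← mul_assoc ((-1 : ℝ) ^ m), ← mul_pow]
  norm_num
  positivity

theorem hasDerivAt_altRem_legF_div (m : ℕ) {t : ℝ} (ht : 0 < t) :
    HasDerivAt (fun t => altRem legF (m + 1) (t ^ 2 / 16) / t)
      (altRem (negDeriv legF) m (t ^ 2 / 16) / 8 - altRem legF (m + 1) (t ^ 2 / 16) / t / t) t := by
  have h0 : HasDerivAt (fun t : ℝ => t ^ 2 / 16) (2 * t / 16) t := by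
    simpa using (hasDerivAt_pow 2 t).div_const 16
  have h1 := (smoothCM_legF.hasDerivAt_altRem m (z := t ^ 2 / 16) (by positivity)).comp t h0
  refine (h1.div (hasDerivAt_id t) ht.ne').congr_deriv ?_
  simp only [Function.comp, id]
  field_simp
  ring

/-- The integrand is the derivative of `exp (-x t) altRem legF (m + 1) (t²/16) / t`, which vanishes
at both ends. Adding it therefore costs nothing, and it brings in the remainder of `-legF'`. -/
theorem integral_by_parts_altRem_legF {x : ℝ} (hx : 0 < x) (m : ℕ) :
    MeasureTheory.IntegrableOn (fun t => exp (-(x * t)) *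
      (altRem (negDeriv legF) m (t ^ 2 / 16) / 8 - altRem legF (m + 1) (t ^ 2 / 16) / t / t -
        x * (altRem legF (m + 1) (t ^ 2 / 16) / t))) (Set.Ioi 0) ∧
    ∫ t in Set.Ioi (0 : ℝ), exp (-(x * t)) *
      (altRem (negDeriv legF) m (t ^ 2 / 16) / 8 - altRem legF (m + 1) (t ^ 2 / 16) / t / t -
        x * (altRem legF (m + 1) (t ^ 2 / 16) / t)) = 0 := by
  set G := altCoeff (negDeriv legF) m / 16 ^ m / 8 with hG
  set D := altCoeff legF (m + 1) / 16 ^ (m + 1) with hD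
  have hc1 := continuousOn_comp_sq_div (smoothCM_legF.continuousOn_altRem (m + 1))
  have hc2 := continuousOn_comp_sq_div (smoothCM_legF.negDeriv.continuousOn_altRem m)
  have hO : ∀ t, 0 < t → altRem legF (m + 1) (t ^ 2 / 16) / t ≤ D * t ^ (2 * m + 1) :=
    fun t ht => altRem_comp_div_le smoothCM_legF m ht
  have hint : MeasureTheory.IntegrableOn (fun t => exp (-(x * t)) *
      (altRem (negDeriv legF) m (t ^ 2 / 16) / 8 - altRem legF (m + 1) (t ^ 2 / 16) / t / t -
        x * (altRem legF (m + 1) (t ^ 2 / 16) / t))) (Set.Ioi 0) := by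
    refine integrableOn_exp_mul (A := G + D) (B := x * D) (k := 2 * m) (j := 2 * m + 1) hx ?_
      fun t ht => ?_
    · have hid : ∀ t ∈ Set.Ioi (0 : ℝ), id t ≠ 0 := fun t ht => ne_of_gt ht
      exact ((hc2.div_const 8).sub ((hc1.div continuousOn_id hid).div continuousOn_id hid)).sub
        (continuousOn_const.mul (hc1.div continuousOn_id hid))
    · have h1 := altRem_comp_le smoothCM_legF.negDeriv m t
      have h2 := smoothCM_legF.negDeriv.altRem_nonneg m (z := t ^ 2 / 16) (by positivity)
      have h3 := hO t ht
      have h4 := altRem_legF_pos m ht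
      have h5 : altRem legF (m + 1) (t ^ 2 / 16) / t / t ≤ D * t ^ (2 * m) := by
        rw [div_le_iff₀ ht, mul_assoc, ← pow_succ]; exact h3
      have h6 := div_pos h4 ht
      have h7 := mul_le_mul_of_nonneg_left h3 hx.le
      have h8 := mul_pos hx h4
      have h9 : altRem (negDeriv legF) m (t ^ 2 / 16) / 8 ≤ G * t ^ (2 * m) := by
        rw [hG]; linarith
      have h10 : 0 ≤ altRem (negDeriv legF) m (t ^ 2 / 16) / 8 := by positivity
      rw [abs_le]
      constructor <;> linarith
  refine ⟨hint, ?_⟩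
  have h := MeasureTheory.integral_Ioi_of_hasDerivAt_of_tendsto
    (f := fun t => exp (-(x * t)) * (altRem legF (m + 1) (t ^ 2 / 16) / t)) (a := 0) (m := 0)
    ?_ (fun t ht => ?_) hint ?_
  · rw [h]; simp
  · have hlim : Tendsto (fun t : ℝ => D * t ^ (2 * m + 1)) (nhdsWithin 0 (Set.Ici 0)) (nhds 0) := by
      have : ContinuousAt (fun t : ℝ => D * t ^ (2 * m + 1)) 0 := by fun_prop
      simpa using this.tendsto.mono_left (nhdsWithin_le_nhds (s := Set.Ici 0))
    -- The convention `x / 0 = 0` gives the correct boundary value, since the quotient is `O(t ^ (2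
    -- m + 1))`.
    rw [ContinuousWithinAt, div_zero, mul_zero]
    refine tendsto_of_tendsto_of_tendsto_of_le_of_le' tendsto_const_nhds hlim ?_ ?_
    · filter_upwards [self_mem_nhdsWithin] with t ht
      rcases (Set.mem_Ici.1 ht).eq_or_lt with rfl | ht
      · simp
      · exact mul_nonneg (exp_pos _).le (altRem_legF_pos m ht).le
    · filter_upwards [self_mem_nhdsWithin] with t ht
      rcases (Set.mem_Ici.1 ht).eq_or_lt with rfl | ht
      · simp
      · have h1 : exp (-(x * t)) ≤ 1 := exp_le_one_iff.2 (by nlinarith)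
        have h2 := altRem_legF_pos m ht
        have h3 := hO t ht
        nlinarith
  · have ht' : 0 < t := ht
    have h1 : HasDerivAt (fun t => exp (-(x * t))) (exp (-(x * t)) * -x) t := by
      have : HasDerivAt (fun t => -(x * t)) (-x) t := by
        simpa [neg_mul] using (hasDerivAt_id t).const_mul (-x)
      exact this.exp
    refine (h1.mul (hasDerivAt_altRem_legF_div m ht')).congr_deriv ?_
    ring
  · have hlim : Tendsto (fun t : ℝ => D * (t ^ (2 * m + 1) * exp (-(x * t)))) atTop (nhds 0) := by
      have := (tendsto_rpow_mul_exp_neg_mul_atTop_nhds_zero ((2 * m + 1 : ℕ) : ℝ) x hx).const_mul D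
      simp only [rpow_natCast, mul_zero, neg_mul] at this
      exact this
    refine tendsto_of_tendsto_of_tendsto_of_le_of_le' tendsto_const_nhds hlim ?_ ?_
    · filter_upwards [eventually_gt_atTop 0] with t ht
      exact mul_nonneg (exp_pos _).le (altRem_legF_pos m ht).le
    · filter_upwards [eventually_gt_atTop 0] with t ht
      have := mul_le_mul_of_nonneg_left (hO t ht) (exp_pos (-(x * t))).le
      linarith

/-- After the null integral is subtracted, the integrand is `exp (-N t)` times a sum of three terms.
The first, `(2 R_Q - R_{-F'}) / 8`, is nonnegative by `CM.altRem_sub_nonneg`; the second, `R_F /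
t²`, is strictly positive; the third is `n R_F / t`. The adverse `-R_F / t` is absorbed because `N -
1 = n ≥ 0`. -/
theorem granathError_even (m n : ℕ) :
    0 < -((-1) ^ m * granathError landauAlpha (2 * m) n) := by
  have hx : (0 : ℝ) < n + 1 := by positivity
  obtain ⟨i1, hparts⟩ := integral_by_parts_altRem_legF hx m
  have i2 := (integrableOn_exp_mul_borelRem hx (2 * m)).const_mul (-(-1) ^ m)
  rw [granathError_landauAlpha, ← neg_mul, ← MeasureTheory.integral_const_mul]
  have h0 := MeasureTheory.integral_sub i2 i1
  rw [hparts, sub_zero] at h0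
  rw [← h0]
  refine integral_Ioi_pos (fun t ht => ?_) (i2.sub i1)
  have h1 := altRem_legF_pos m ht
  have h2 := div_pos h1 ht
  have h3 := CM.altRem_sub_nonneg (by norm_num) cm_legQ cm_legF cm_two_mul_legQ_sub_negDeriv_legF m
    (z := t ^ 2 / 16) (by positivity)
  have h4 : (0 : ℝ) ≤ n := Nat.cast_nonneg n
  have h5 := mul_nonneg h4 h1.le
  have hs : ((-1 : ℝ) ^ m) * (-1) ^ m = 1 := by rw [← mul_pow]; simp
  rw [(borelRem_even_and_odd m ht).1]
  have e : -(-1) ^ m * (exp (-(((n : ℝ) + 1) * t)) * ((-1) ^ m *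
      (altRem legF (m + 1) (t ^ 2 / 16) / t - altRem legQ m (t ^ 2 / 16) / 4))) -
      exp (-(((n : ℝ) + 1) * t)) * (altRem (negDeriv legF) m (t ^ 2 / 16) / 8 -
        altRem legF (m + 1) (t ^ 2 / 16) / t / t -
        ((n : ℝ) + 1) * (altRem legF (m + 1) (t ^ 2 / 16) / t)) =
      exp (-(((n : ℝ) + 1) * t)) * ((2 * altRem legQ m (t ^ 2 / 16) -
        altRem (negDeriv legF) m (t ^ 2 / 16)) / 8 + altRem legF (m + 1) (t ^ 2 / 16) / t / t +
        n * (altRem legF (m + 1) (t ^ 2 / 16) / t)) := by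
    linear_combination (-exp (-(((n : ℝ) + 1) * t)) * (altRem legF (m + 1) (t ^ 2 / 16) / t -
      altRem legQ m (t ^ 2 / 16) / 4)) * hs
  rw [e]
  exact mul_pos (exp_pos _) (by linarith)

theorem theorem2 :
    (∃ α : ℕ → ℝ, IsGranathExpansion α) ∧
      ∀ α : ℕ → ℝ, IsGranathExpansion α →
        ∀ l n : ℕ, (-1 : ℝ) ^ (l * (l + 1) / 2) * granathError α l n < 0 := by
  refine ⟨⟨landauAlpha, isGranathExpansion_landauAlpha⟩, fun α hα l n => ?_⟩
  rw [granathError_congr (hα.eq isGranathExpansion_landauAlpha)]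
  obtain ⟨m, rfl | rfl⟩ := Nat.even_or_odd' l
  -- Modulo `2` the exponent is `m` for `l = 2 m` and `m + 1` for `l = 2 m + 1`.
  · have e : 2 * m * (2 * m + 1) / 2 = m + 2 * (m * m) := by
      rw [show 2 * m * (2 * m + 1) = 2 * (m + 2 * (m * m)) by ring]
      exact Nat.mul_div_cancel_left _ two_pos
    rw [e, pow_add, pow_mul, neg_one_sq, one_pow, mul_one]
    exact neg_pos.1 (granathError_even m n)
  · have e : (2 * m + 1) * (2 * m + 1 + 1) / 2 = m + 2 * (m * m + m) + 1 := by
      rw [show (2 * m + 1) * (2 * m + 1 + 1) = 2 * (m + 2 * (m * m + m) + 1) by ring]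
      exact Nat.mul_div_cancel_left _ two_pos
    rw [e, pow_succ, pow_add, pow_mul, neg_one_sq, one_pow, mul_one, mul_neg_one, neg_mul, neg_lt_zero]
    exact granathError_odd m n
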